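/- **Notation.** For a power series $\varphi(x)=\sum_{k\ge 0}\varphi_k x^k$ with real coefficients let $M(\varphi,n)\in\mathbb{R}^{n\times n}$ be the lower triangular Toeplitz matrix with entries $M(\varphi,n)_{i,j}=\varphi_{i-j}$ for $i\ge j$ and $0$ for $i<j$. Let $A=M(1/(1-x),n)$ be the lower triangular all-ones matrix, and put $$\|B\|_{2\to\infty}=\max_i\Big(\sum_j B_{i,j}^2\Big)^{1/2},\qquad \|C\|_{1\to2}=\max_j\Big(\sum_i C_{i,j}^2\Big)^{1/2}.$$ Let $B^*=C^*=M(f,n)$, where $f(x)=1/\sqrt{1-x}$ (Taylor series at $0$). A *BLT recurrence with $k$ buffers* is given by $u,v\in\mathbb{R}^{k}$, $W\in\mathbb{R}^{k\times k}$ with at most two nonzero entries in each row, and $t\in\mathbb{R}$; it maps a stream of rows $Z_0,Z_1,\dots\in\mathbb{R}^{1\times m}$ to the stream $\widehat Z_i=tZ_i+u^{T}S_{i+1}$, where $S_0=0\in\mathbb{R}^{k\times m}$ and $S_{i+1}=vZ_i+WS_i$. **Theorem.** Let $n\ge 5$ and $d$ be integers with $d\ge 2+\left(\frac{12+4\log n}{\pi}\right)^2$.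 Then $B^*C^*=A$ is an optimal lower triangular Toeplitz factorization of $A$: it minimizes $\|B'\|_{2\to\infty}\|C'\|_{1\to2}$ over all lower triangular Toeplitz $B',C'\in\mathbb{R}^{n\times n}$ with $B'C'=A$. Moreover, there are lower triangular Toeplitz matrices $B,C\in\mathbb{R}^{n\times n}$ with $A=BC$ and the following properties. 1. *Near-optimality.* $$\|B\|_{2\to\infty}\le\|B^*\|_{2\to\infty}+16\sqrt n\,\exp\!\left(-\tfrac{\pi}{2}\sqrt{d-2}\right),\qquad \|C\|_{1\to2}\le\|C^*\|_{1\to2}+16\sqrt n\,\exp\!\left(-\tfrac{\pi}{2}\sqrt{d-2}\right).$$ 2. *Rational generating function.* There is a rational function $r=p/q$, with real polynomials $p,q$ of degree at most $d$, $q(0)=1$ and $p(0)\ne0$, such that $B=M\big(r(x)/(1-x),n\big)$, $C=M(1/r,n)$ and $C^{-1}=M(r,n)$. The map $Z\mapsto C^{-1}Z$ is computed row by row by a BLT recurrence with $d$ buffers, and $Z\mapsto BZ$ by one with $d+1$ buffers. 3. *Efficiency.* For every $m\ge1$ there is a streaming algorithm that receives the rows of $Z\in\mathbb{R}^{n\times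 m}$ one at a time and outputs row $i$ of $\widehat Z=C^{-1}Z$ before it receives row $i+1$ of $Z$, in space $O(dm)$ and time $O(dm)$ per row. The same holds for $\widehat Z=BZ$. Here the cost model is a random access machine with exact real arithmetic: a real number occupies one unit of memory, an elementary operation takes one unit of time, and the real parameters of the algorithm are given and count towards the space. For each of the two tasks the program is one fixed program, which is told $d$ and $m$ and is supplied with the real parameters, and the constants in $O(dm)$ are absolute. -/

import Mathlib

open scoped PowerSeries Polynomial

/-! ### Lower triangular Toeplitz matrices, generating functions and norms -/

/-- The `n × n` lower triangular all-ones matrix. -/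
def onesLT (n : ℕ) : Matrix (Fin n) (Fin n) ℝ :=
  Matrix.of fun i j => if j ≤ i then 1 else 0

/-- The `n × n` lower triangular Toeplitz matrix `M(φ, n)` generated by `φ = ∑ φₖ xᵏ`:
its `(i, j)` entry is `φ_{i-j}` for `i ≥ j` and `0` otherwise. -/
noncomputable def genMatrix (φ : ℝ⟦X⟧) (n : ℕ) : Matrix (Fin n) (Fin n) ℝ :=
  Matrix.of fun i j => if j ≤ i then PowerSeries.coeff ((i : ℕ) - (j : ℕ)) φ else 0

/-- `M` is lower triangular Toeplitz. -/
def IsLTToeplitz {n : ℕ} (M : Matrix (Fin n) (Fin n) ℝ) : Prop :=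
  ∃ c : ℕ → ℝ, ∀ i j : Fin n, M i j = if j ≤ i then c ((i : ℕ) - (j : ℕ)) else 0

/-- The Taylor series `∑ g⁽ᵏ⁾(0)/k! xᵏ` at `0` of a real function. -/
noncomputable def taylorSeries (g : ℝ → ℝ) : ℝ⟦X⟧ :=
  PowerSeries.mk fun k => iteratedDeriv k g 0 / (Nat.factorial k : ℝ)

/-- The matrix `M(f, n)` for `f(x) = 1 / √(1 - x)`. -/
noncomputable def optFactor (n : ℕ) : Matrix (Fin n) (Fin n) ℝ :=
  genMatrix (taylorSeries fun x => 1 / Real.sqrt (1 - x)) n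

/-- `‖B‖_{2→∞}`: the largest Euclidean norm of a row. -/
noncomputable def rowNorm {n : ℕ} (B : Matrix (Fin n) (Fin n) ℝ) : ℝ :=
  ⨆ i, Real.sqrt (∑ j, B i j ^ 2)

/-- `‖C‖_{1→2}`: the largest Euclidean norm of a column. -/
noncomputable def colNorm {n : ℕ} (C : Matrix (Fin n) (Fin n) ℝ) : ℝ :=
  ⨆ j, Real.sqrt (∑ i, C i j ^ 2)

/-! ### Buffered linear Toeplitz (BLT) recurrences -/

/-- The buffers `S₀ = 0`, `Sₖ₊₁ = v Zₖ + W Sₖ` driven by the stream of rows `Z₀, Z₁, …`. -/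
noncomputable def bltState {d m : ℕ} (W : Matrix (Fin d) (Fin d) ℝ) (v : Fin d → ℝ)
    (z : ℕ → Fin m → ℝ) : ℕ → Matrix (Fin d) (Fin m) ℝ
  | 0 => 0
  | k + 1 => Matrix.vecMulVec v (z k) + W * bltState W v z k

/-- The `k`-th output row `t Zₖ + uᵀ Sₖ₊₁`. -/
noncomputable def bltOutput {d m : ℕ} (u v : Fin d → ℝ) (W : Matrix (Fin d) (Fin d) ℝ) (t : ℝ)
    (z : ℕ → Fin m → ℝ) (k : ℕ) : Fin m → ℝ :=
  t • z k + Matrix.vecMul u (bltState W v z (k + 1))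

/-- The matrix whose rows are the first `n` rows of the stream `z`. -/
def streamMatrix {m : ℕ} (n : ℕ) (z : ℕ → Fin m → ℝ) : Matrix (Fin n) (Fin m) ℝ :=
  Matrix.of fun i l => z i l

/-- Multiplication by `M` is carried out, row by row, by a BLT recurrence with `d` buffers whose
transition matrix has at most two nonzero entries in each row. -/
def HasBLTRecurrence (d : ℕ) {n : ℕ} (M : Matrix (Fin n) (Fin n) ℝ) : Prop :=
  ∃ (u v : Fin d → ℝ) (W : Matrix (Fin d) (Fin d) ℝ) (t : ℝ),
    (∀ i, {j | W i j ≠ 0}.ncard ≤ 2) ∧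
    ∀ (m : ℕ) (z : ℕ → Fin m → ℝ) (k : Fin n),
      bltOutput u v W t z k = (M * streamMatrix n z) k

/-! ### A real random access machine with step count

The machine has `r` index registers holding natural numbers and `S` memory cells holding real
numbers; cells are addressed indirectly, through the index registers. Real arithmetic is exact and
atomic. There are no branches on real data and no conversions between reals and indices.
Each elementary instruction costs one unit of time. -/

/-- Programs with `r` index registers. -/
inductive Prog (r : ℕ) : Type
  /-- `x := c` on index registers -/
  | iconst (x : Fin r) (c : ℕ) : Prog r
  /-- `x := y + y'` on index registers -/
  | iadd (x y y' : Fin r) : Prog r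
  /-- `x := y * y'` on index registers -/
  | imul (x y y' : Fin r) : Prog r
  /-- `mem[x] := c` -/
  | rconst (x : Fin r) (c : ℝ) : Prog r
  /-- `mem[x] := mem[y] + mem[y']` -/
  | radd (x y y' : Fin r) : Prog r
  /-- `mem[x] := mem[y] - mem[y']` -/
  | rsub (x y y' : Fin r) : Prog r
  /-- `mem[x] := mem[y] * mem[y']` -/
  | rmul (x y y' : Fin r) : Prog r
  /-- first `p`, then `p'` -/
  | seq (p p' : Prog r) : Prog r
  /-- repeat `p`, as many times as the value of `x` on entry says -/
  | loop (x : Fin r) (p : Prog r) : Prog r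

/-- Machine states with `r` index registers and `S` memory cells. -/
structure MState (r S : ℕ) where
  idx : Fin r → ℕ
  mem : Fin S → ℝ

/-- The content of cell `a`; there are only `S` cells, any other address reads as `0`. -/
def MState.read {r S : ℕ} (s : MState r S) (a : ℕ) : ℝ :=
  if h : a < S then s.mem ⟨a, h⟩ else 0

/-- Write `c` to cell `a`; without effect if there is no such cell. -/
def MState.write {r S : ℕ} (s : MState r S) (a : ℕ) (c : ℝ) : MState r S :=
  { s with mem := fun b => if (b : ℕ) = a then c else s.mem b }

/-- Set index register `x` to `c`. -/
def MState.setIdx {r S : ℕ} (s : MState r S) (x : Fin r) (c : ℕ) : MState r S :=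
  { s with idx := Function.update s.idx x c }

/-- Execution: the final state and the number of elementary steps. -/
noncomputable def Prog.exec {r S : ℕ} : Prog r → MState r S → MState r S × ℕ
  | .iconst x c, s => (s.setIdx x c, 1)
  | .iadd x y y', s => (s.setIdx x (s.idx y + s.idx y'), 1)
  | .imul x y y', s => (s.setIdx x (s.idx y * s.idx y'), 1)
  | .rconst x c, s => (s.write (s.idx x) c, 1)
  | .radd x y y', s => (s.write (s.idx x) (s.read (s.idx y) + s.read (s.idx y')), 1)
  | .rsub x y y', s => (s.write (s.idx x) (s.read (s.idx y) - s.read (s.idx y')), 1)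
  | .rmul x y y', s => (s.write (s.idx x) (s.read (s.idx y) * s.read (s.idx y')), 1)
  | .seq p p', s =>
      ((p'.exec (p.exec s).1).1, (p.exec s).2 + (p'.exec (p.exec s).1).2)
  | .loop x p, s =>
      (fun q : MState r S × ℕ => ((p.exec q.1).1, q.2 + 1 + (p.exec q.1).2))^[s.idx x] (s, 1)

/-- Receive a row of input: it is stored in the cells `0, …, m - 1`. -/
def MState.load {r S m : ℕ} (s : MState r S) (row : Fin m → ℝ) : MState r S :=
  { s with mem := fun b => if h : (b : ℕ) < m then row ⟨b, h⟩ else s.mem b }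

/-- Initial state: index registers `0` and `1` hold `d` and `m`, all others hold `0`; the memory
holds the real parameters `par` of the algorithm. -/
def MState.init {r S : ℕ} (d m : ℕ) (par : Fin S → ℝ) : MState r S where
  idx x := if (x : ℕ) = 0 then d else if (x : ℕ) = 1 then m else 0
  mem := par

/-- The state after `k` iterations of `p`; in iteration `k` the row `z k` is received and `p` is
executed once. All registers and cells keep their contents between iterations. -/
noncomputable def Prog.stateAfter {r S m : ℕ} (p : Prog r) (d : ℕ) (par : Fin S → ℝ)
    (z : ℕ → Fin m → ℝ) : ℕ → MState r S
  | 0 => MState.init d m par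
  | k + 1 => (p.exec ((p.stateAfter d par z k).load (z k))).1

/-- The row emitted at the end of iteration `k`: the contents of the cells `m, …, 2 m - 1`. -/
noncomputable def Prog.output {r S m : ℕ} (p : Prog r) (d : ℕ) (par : Fin S → ℝ)
    (z : ℕ → Fin m → ℝ) (k : ℕ) : Fin m → ℝ :=
  fun l => (p.stateAfter d par z (k + 1)).read (m + l)

/-- The time of iteration `k`: receiving `m` numbers, executing `p`, emitting `m` numbers. -/
noncomputable def Prog.iterTime {r S m : ℕ} (p : Prog r) (d : ℕ) (par : Fin S → ℝ)
    (z : ℕ → Fin m → ℝ) (k : ℕ) : ℕ :=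
  m + (p.exec ((p.stateAfter d par z k).load (z k))).2 + m

/-- With suitable real parameters the program `p` (which is told `d` and `m`) is a streaming
algorithm for `Z ↦ M Z`, `Z` with `m` columns: after receiving row `k` of `Z` and before receiving
the next one it emits row `k` of `M Z`. The total space (memory cells, including those for
parameters, input and output, and index registers) and the time of each iteration are at
most `bound`. -/
def Prog.StreamsWithin {r : ℕ} (p : Prog r) (d m : ℕ) {n : ℕ} (M : Matrix (Fin n) (Fin n) ℝ)
    (bound : ℕ) : Prop :=
  ∃ (S : ℕ) (par : Fin S → ℝ), S + r ≤ bound ∧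
    ∀ (z : ℕ → Fin m → ℝ) (k : Fin n),
      p.output d par z k = (M * streamMatrix n z) k ∧ p.iterTime d par z k ≤ bound

/-! ### Lower triangular Toeplitz matrices as truncated power series -/

/-! Lower triangular Toeplitz matrices multiply like power series modulo `x^n`, and both norms
become the Euclidean norm of the first `n` coefficients (`coeffNorm`). Write `F = 1/√(1-x)`.

Optimality has a dual certificate. A nonnegative Hankel matrix, with weights `w (j+l)` vanishing for
`j + l ≥ n`, has the positive vector of coefficients of `F` as an eigenvector for the eigenvalue 1.
By the Schur test its bilinear form is at most `coeffNorm φ n * coeffNorm ψ n`. The form sees only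
`φψ` modulo `x^n`, and at `φ = ψ = F` the bound is attained (`coeffNorm_mul_self_le`).

Near-optimality uses Newman's approximation. Put `z = √(1-x)` and split `∏ (aᵢ + z) = U(z²) + z
V(z²)`. If the product at `-z` is much smaller than at `z`, then `V/U` and `U/(z²V)`, taken at `z²`,
are both close to `1/z`. Hence the single rational function `r = (1-x) V(1-x) / U(1-x)` makes both
`r/(1-x)` and `1/r` close to `F`. For `‖x‖ ≤ 1 - 1/n`, `z` lies in the sector `|arg z| < π/4` with
`n^(-1/2) ≤ |z| ≤ √2`. Nodes spaced geometrically along this range, each repeated, leave one node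
near `|z|`, which supplies the decay (`exists_newman_approximation`). Cauchy's estimate on the
circle of radius `1 - 1/n` passes from the disc to coefficients (`coeffNorm_sub_le_of_approx`).

Efficiency comes from running `p/q` as a recursive filter with `d` registers in transposed direct
form: each update reads only registers 1 and `i + 1`. The same filter is both the BLT recurrence and
the streaming program, which updates the registers in place. -/

lemma coeff_mul_range {R : Type*} [CommSemiring R] (φ ψ : R⟦X⟧) (n : ℕ) :
    PowerSeries.coeff n (φ * ψ) =
      ∑ k ∈ Finset.range (n + 1), PowerSeries.coeff k φ * PowerSeries.coeff (n - k) ψ := by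
  rw [PowerSeries.coeff_mul,
    Finset.Nat.sum_antidiagonal_eq_sum_range_succ
      (fun i j => PowerSeries.coeff i φ * PowerSeries.coeff j ψ)]

lemma isLTToeplitz_genMatrix (φ : ℝ⟦X⟧) (n : ℕ) : IsLTToeplitz (genMatrix φ n) :=
  ⟨fun k => PowerSeries.coeff k φ, fun _ _ => rfl⟩

lemma IsLTToeplitz.exists_eq_genMatrix {n : ℕ} {M : Matrix (Fin n) (Fin n) ℝ}
    (h : IsLTToeplitz M) : ∃ φ : ℝ⟦X⟧, M = genMatrix φ n := by
  obtain ⟨c, hc⟩ := h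
  refine ⟨PowerSeries.mk c, ?_⟩
  funext i j
  simp [genMatrix, hc]

lemma sum_fin_ite_le {n : ℕ} (i : Fin n) (g : ℕ → ℝ) :
    ∑ j : Fin n, (if j ≤ i then g j else 0) = ∑ j ∈ Finset.range (i + 1), g j := by
  have : ∀ j : Fin n, (if j ≤ i then g j else 0) = (fun j : ℕ => if j ≤ (i : ℕ) then g j else 0) j :=
    fun j => by simp only [Fin.le_def]
  rw [Finset.sum_congr rfl fun j _ => this j,
    Fin.sum_univ_eq_sum_range (fun j : ℕ => if j ≤ (i : ℕ) then g j else 0), ← Finset.sum_filter]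
  refine Finset.sum_congr ?_ fun _ _ => rfl
  ext j
  simp only [Finset.mem_filter, Finset.mem_range]
  omega

lemma genMatrix_mulVec_apply {n : ℕ} (φ : ℝ⟦X⟧) (i : Fin n) (g : ℕ → ℝ) :
    ∑ j : Fin n, genMatrix φ n i j * g j =
      ∑ j ∈ Finset.range (i + 1), PowerSeries.coeff (i - j) φ * g j := by
  rw [← sum_fin_ite_le i fun j => PowerSeries.coeff (i - j) φ * g j]
  exact Finset.sum_congr rfl fun j _ => by by_cases h : j ≤ i <;> simp [genMatrix, h]

lemma genMatrix_mul (φ ψ : ℝ⟦X⟧) (n : ℕ) :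
    genMatrix φ n * genMatrix ψ n = genMatrix (φ * ψ) n := by
  ext i j
  have h := genMatrix_mulVec_apply φ i
    (fun l => if (j : ℕ) ≤ l then PowerSeries.coeff (l - j) ψ else 0)
  have h' : (genMatrix φ n * genMatrix ψ n) i j = ∑ l : Fin n, genMatrix φ n i l *
      (if (j : ℕ) ≤ (l : ℕ) then PowerSeries.coeff ((l : ℕ) - j) ψ else 0) := by
    simp only [Matrix.mul_apply, genMatrix, Matrix.of_apply, Fin.le_def]
  rw [h', h]
  by_cases hij : j ≤ i
  · have hij' : (j : ℕ) ≤ i := hij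
    rw [show (i : ℕ) + 1 = j + (i - j + 1) by omega, Finset.sum_range_add]
    rw [Finset.sum_eq_zero fun x hx => by
      rw [if_neg (by simpa using hx), mul_zero], zero_add]
    simp only [genMatrix, Matrix.of_apply, if_pos hij]
    rw [mul_comm φ ψ, coeff_mul_range]
    refine Finset.sum_congr rfl fun k _ => ?_
    rw [if_pos (by omega), mul_comm, show (j : ℕ) + k - j = k by omega,
      show (i : ℕ) - (j + k) = i - j - k by omega]
  · simp only [genMatrix, Matrix.of_apply, if_neg hij]
    refine Finset.sum_eq_zero fun x hx => ?_
    rw [if_neg, mul_zero]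
    rw [Fin.le_def] at hij
    rw [Finset.mem_range] at hx
    omega

lemma genMatrix_one (n : ℕ) : genMatrix 1 n = 1 := by
  ext i j
  simp only [genMatrix, Matrix.of_apply, PowerSeries.coeff_one, Matrix.one_apply, Fin.le_def,
    Fin.ext_iff]
  split_ifs <;> first | rfl | omega

lemma genMatrix_geometric (n : ℕ) : genMatrix (1 - PowerSeries.X)⁻¹ n = onesLT n := by
  have h : ((1 - PowerSeries.X)⁻¹ : ℝ⟦X⟧) = PowerSeries.mk 1 := by
    rw [PowerSeries.inv_eq_iff_mul_eq_one (by simp)]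
    exact PowerSeries.mk_one_mul_one_sub_eq_one ℝ
  ext i j
  simp [genMatrix, onesLT, h]

lemma genMatrix_inv {φ ψ : ℝ⟦X⟧} (h : φ * ψ = 1) (n : ℕ) :
    (genMatrix φ n)⁻¹ = genMatrix ψ n :=
  Matrix.inv_eq_right_inv (by rw [genMatrix_mul, h, genMatrix_one])

/-- The Euclidean norm of the first `n` coefficients of a power series. -/
noncomputable def coeffNorm (φ : ℝ⟦X⟧) (n : ℕ) : ℝ :=
  √(∑ k ∈ Finset.range n, PowerSeries.coeff k φ ^ 2)

lemma sum_coeff_sq_le (φ : ℝ⟦X⟧) {k n : ℕ} (h : k ≤ n) :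
    ∑ k ∈ Finset.range k, PowerSeries.coeff k φ ^ 2 ≤
      ∑ k ∈ Finset.range n, PowerSeries.coeff k φ ^ 2 :=
  Finset.sum_le_sum_of_subset_of_nonneg (Finset.range_mono h) fun _ _ _ => sq_nonneg _

lemma sum_row_sq (φ : ℝ⟦X⟧) {n : ℕ} (i : Fin n) :
    ∑ j, genMatrix φ n i j ^ 2 = ∑ k ∈ Finset.range (i + 1), PowerSeries.coeff k φ ^ 2 := by
  rw [← Finset.sum_range_reflect, ← sum_fin_ite_le]
  refine Finset.sum_congr rfl fun j _ => ?_
  by_cases h : j ≤ i <;> simp [genMatrix, h]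

/-- Reflection in the antidiagonal preserves a Toeplitz matrix and turns column `j` into row
`Fin.rev j`. -/
lemma sum_col_sq (φ : ℝ⟦X⟧) {n : ℕ} (j : Fin n) :
    ∑ i, genMatrix φ n i j ^ 2 = ∑ k ∈ Finset.range (n - j), PowerSeries.coeff k φ ^ 2 := by
  rw [← Equiv.sum_comp Fin.revPerm]
  have h := sum_row_sq φ (Fin.rev j)
  rw [← Equiv.sum_comp Fin.revPerm] at h
  rw [Fin.val_rev, show n - (j + 1) + 1 = n - j by omega] at h
  rw [← h, ← Equiv.sum_comp Fin.revPerm]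
  refine Finset.sum_congr rfl fun i _ => ?_
  simp only [genMatrix, Matrix.of_apply, Fin.revPerm_apply, Fin.rev_rev, Fin.le_def, Fin.val_rev]
  have hi := i.2
  have hj := j.2
  by_cases h : (j : ℕ) ≤ i
  · rw [if_pos h, if_pos (by omega)]
    congr 3
    omega
  · rw [if_neg h, if_neg (by omega)]

/-- Rows are nested initial segments of the coefficient sequence, so the last row is the longest;
for columns it is the first. -/
lemma rowNorm_genMatrix (φ : ℝ⟦X⟧) {n : ℕ} (hn : 0 < n) :
    rowNorm (genMatrix φ n) = coeffNorm φ n := by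
  have : Nonempty (Fin n) := ⟨⟨0, hn⟩⟩
  refine le_antisymm (ciSup_le fun i => ?_) ?_
  · rw [sum_row_sq]
    exact Real.sqrt_le_sqrt (sum_coeff_sq_le φ i.2)
  · refine le_of_eq_of_le ?_ (le_ciSup (Set.finite_range _).bddAbove (⟨n - 1, by omega⟩ : Fin n))
    rw [sum_row_sq, coeffNorm]
    simp [Nat.sub_add_cancel hn]

lemma colNorm_genMatrix (φ : ℝ⟦X⟧) {n : ℕ} (hn : 0 < n) :
    colNorm (genMatrix φ n) = coeffNorm φ n := by
  have : Nonempty (Fin n) := ⟨⟨0, hn⟩⟩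
  refine le_antisymm (ciSup_le fun i => ?_) ?_
  · rw [sum_col_sq]
    exact Real.sqrt_le_sqrt (sum_coeff_sq_le φ (Nat.sub_le _ _))
  · refine le_of_eq_of_le ?_ (le_ciSup (Set.finite_range _).bddAbove (⟨0, hn⟩ : Fin n))
    rw [sum_col_sq, coeffNorm]
    simp

lemma coeffNorm_le_add (φ ψ : ℝ⟦X⟧) (n : ℕ) :
    coeffNorm φ n ≤ coeffNorm ψ n + coeffNorm (φ - ψ) n := by
  have key : ∀ χ : ℝ⟦X⟧, coeffNorm χ n =
      ‖WithLp.toLp 2 fun k : Fin n => PowerSeries.coeff (k : ℕ) χ‖ := fun χ => by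
    rw [EuclideanSpace.norm_eq, coeffNorm]
    congr 1
    rw [← Fin.sum_univ_eq_sum_range (fun k => PowerSeries.coeff k χ ^ 2)]
    simp
  rw [key, key, key]
  refine le_of_eq_of_le ?_ (norm_add_le _ _)
  congr 1
  ext k
  simp

lemma coeffNorm_le_of_abs_le {φ : ℝ⟦X⟧} {n : ℕ} {M : ℝ} (hM : 0 ≤ M)
    (h : ∀ k < n, |PowerSeries.coeff k φ| ≤ M) : coeffNorm φ n ≤ √n * M := by
  rw [coeffNorm, ← Real.sqrt_sq hM, ← Real.sqrt_mul n.cast_nonneg]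
  refine Real.sqrt_le_sqrt ?_
  calc _ ≤ ∑ k ∈ Finset.range n, M ^ 2 := Finset.sum_le_sum fun k hk =>
        sq_le_sq' (neg_le_of_abs_le (h k (Finset.mem_range.1 hk)))
          (le_of_abs_le (h k (Finset.mem_range.1 hk)))
    _ = _ := by simp

/-! ### The coefficients of `1 / √(1 - x)` and the optimal factorization -/

/-- Differentiating the equation and cancelling `F` gives `2 F' (1 - x) = F`, read off
coefficientwise. Positivity and monotonicity of the coefficients follow from this ratio. -/
lemma coeff_succ_of_sq_mul {F : ℝ⟦X⟧} (hF : F ^ 2 * (1 - PowerSeries.X) = 1) (k : ℕ) :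
    2 * (k + 1) * PowerSeries.coeff (k + 1) F = (2 * k + 1) * PowerSeries.coeff k F := by
  have hF0 : F ≠ 0 := by
    rintro rfl
    simp at hF
  have h : F * (2 * (PowerSeries.derivative ℝ F) * (1 - PowerSeries.X) - F) = 0 := by
    have := congrArg (PowerSeries.derivative ℝ) hF
    rw [Derivation.leibniz, Derivation.map_one_eq_zero, map_sub, PowerSeries.derivative_X,
      Derivation.map_one_eq_zero, pow_two, Derivation.leibniz] at this
    simp only [smul_eq_mul] at this
    linear_combination this
  have h2 : 2 * (PowerSeries.derivative ℝ F) * (1 - PowerSeries.X) - F = 0 :=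
    (mul_eq_zero.1 h).resolve_left hF0
  have h3 : PowerSeries.derivative ℝ F + PowerSeries.derivative ℝ F =
      (PowerSeries.derivative ℝ F + PowerSeries.derivative ℝ F) * PowerSeries.X + F := by
    linear_combination h2
  have h4 := congrArg (PowerSeries.coeff k) h3
  cases k with
  | zero =>
    simp only [map_add, PowerSeries.coeff_zero_mul_X, PowerSeries.coeff_derivative] at h4
    push_cast at h4 ⊢
    linarith
  | succ k =>
    simp only [map_add, PowerSeries.coeff_succ_mul_X, PowerSeries.coeff_derivative] at h4
    push_cast at h4 ⊢
    linarith

lemma coeff_pos_of_sq_mul {F : ℝ⟦X⟧} (hF : F ^ 2 * (1 - PowerSeries.X) = 1)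
    (h0 : PowerSeries.coeff 0 F = 1) (k : ℕ) : 0 < PowerSeries.coeff k F := by
  induction k with
  | zero => simp [h0]
  | succ k ih =>
    have h := coeff_succ_of_sq_mul hF k
    have : 0 < 2 * ((k : ℝ) + 1) * PowerSeries.coeff (k + 1) F := by rw [h]; positivity
    exact pos_of_mul_pos_right this (by positivity)

lemma coeff_antitone_of_sq_mul {F : ℝ⟦X⟧} (hF : F ^ 2 * (1 - PowerSeries.X) = 1)
    (h0 : PowerSeries.coeff 0 F = 1) : Antitone fun k => PowerSeries.coeff k F := by
  refine antitone_nat_of_succ_le fun k => ?_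
  have h := coeff_succ_of_sq_mul hF k
  have := coeff_pos_of_sq_mul hF h0 k
  have := coeff_pos_of_sq_mul hF h0 (k + 1)
  have hk : (0 : ℝ) ≤ k := k.cast_nonneg
  nlinarith

/-- The Hankel weights certifying the optimality of `F = 1 / √(1 - x)`. -/
noncomputable def hankelWeight (F : ℝ⟦X⟧) (n k : ℕ) : ℝ :=
  ∑ l ∈ Finset.range (n - k),
    PowerSeries.coeff l (F * (1 - PowerSeries.X)) * PowerSeries.coeff (k + l) F

lemma coeff_mul_one_sub_X (F : ℝ⟦X⟧) (k : ℕ) :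
    PowerSeries.coeff (k + 1) (F * (1 - PowerSeries.X)) =
      PowerSeries.coeff (k + 1) F - PowerSeries.coeff k F := by
  rw [mul_sub, mul_one, map_sub, PowerSeries.coeff_succ_mul_X]

lemma sum_coeff_mul_one_sub_X (F : ℝ⟦X⟧) (k : ℕ) :
    ∑ l ∈ Finset.range (k + 1), PowerSeries.coeff l (F * (1 - PowerSeries.X)) =
      PowerSeries.coeff k F := by
  induction k with
  | zero => simp
  | succ k ih => rw [Finset.sum_range_succ, ih, coeff_mul_one_sub_X]; ring

/-- After the constant term, the coefficients of `F (1 - x) = √(1-x)` are nonpositive because those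
of `F` decrease. Replacing `F_{k+l}` by the larger `F_k` therefore only lowers the sum, which then
telescopes to a product of two positive coefficients. -/
lemma hankelWeight_nonneg {F : ℝ⟦X⟧} (hF : F ^ 2 * (1 - PowerSeries.X) = 1)
    (h0 : PowerSeries.coeff 0 F = 1) (n k : ℕ) : 0 ≤ hankelWeight F n k := by
  rcases hN : n - k with _ | N
  · simp [hankelWeight, hN]
  have hanti := coeff_antitone_of_sq_mul hF h0
  calc 0 ≤ PowerSeries.coeff N F * PowerSeries.coeff k F :=
        mul_nonneg (coeff_pos_of_sq_mul hF h0 _).le (coeff_pos_of_sq_mul hF h0 _).le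
    _ = ∑ l ∈ Finset.range (N + 1),
        PowerSeries.coeff l (F * (1 - PowerSeries.X)) * PowerSeries.coeff k F := by
      rw [← Finset.sum_mul, sum_coeff_mul_one_sub_X]
    _ ≤ hankelWeight F n k := by
      rw [hankelWeight, hN]
      refine Finset.sum_le_sum fun l _ => ?_
      cases l with
      | zero => simp
      | succ l =>
        refine mul_le_mul_of_nonpos_left (hanti (by omega)) ?_
        rw [coeff_mul_one_sub_X]
        exact sub_nonpos.2 (hanti (Nat.le_succ l))

/-- The eigenvector property. Grouping the double sum by `s = l + i` produces the coefficients of `F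
· F(1 - x) = 1`, so only `s = 0` survives. -/
lemma sum_hankelWeight_mul {F : ℝ⟦X⟧} (hF : F ^ 2 * (1 - PowerSeries.X) = 1) {n j : ℕ}
    (hj : j < n) :
    ∑ l ∈ Finset.range n, hankelWeight F n (j + l) * PowerSeries.coeff l F =
      PowerSeries.coeff j F := by
  have hsub : ∑ l ∈ Finset.range n, hankelWeight F n (j + l) * PowerSeries.coeff l F =
      ∑ l ∈ Finset.range (n - j), hankelWeight F n (j + l) * PowerSeries.coeff l F := by
    refine (Finset.sum_subset (Finset.range_mono (Nat.sub_le n j)) fun l _ hl => ?_).symm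
    have : n - (j + l) = 0 := by
      rw [Finset.mem_range] at hl
      omega
    simp [hankelWeight, this]
  rw [hsub]
  calc _ = ∑ l ∈ Finset.range (n - j), ∑ i ∈ Finset.range (n - j - l), PowerSeries.coeff l F *
          PowerSeries.coeff i (F * (1 - PowerSeries.X)) * PowerSeries.coeff (j + (l + i)) F := by
        refine Finset.sum_congr rfl fun l _ => ?_
        rw [hankelWeight, Finset.sum_mul, Nat.sub_sub]
        refine Finset.sum_congr rfl fun i _ => ?_
        rw [add_assoc]
        ring
    _ = ∑ s ∈ Finset.range (n - j), PowerSeries.coeff s (F * (F * (1 - PowerSeries.X))) *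
          PowerSeries.coeff (j + s) F := by
        rw [← Finset.sum_range_diag_flip]
        refine Finset.sum_congr rfl fun s _ => ?_
        rw [coeff_mul_range, Finset.sum_mul]
        refine Finset.sum_congr rfl fun k hk => ?_
        rw [Nat.add_sub_cancel' (Nat.lt_succ_iff.1 (Finset.mem_range.1 hk))]
    _ = PowerSeries.coeff j F := by
        rw [show F * (F * (1 - PowerSeries.X)) = 1 by linear_combination hF]
        rw [Finset.sum_eq_single_of_mem 0 (by simpa using hj)]
        · simp
        · intro b _ hb
          simp [PowerSeries.coeff_one, hb]

/-- A Hankel form depends on `φ` and `ψ` only through their product, and the weights vanish from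
index `n` on. So every factorization of the same matrix gives it the same value. -/
lemma sum_hankelWeight_mul_mul (F φ ψ : ℝ⟦X⟧) (n : ℕ) :
    ∑ k ∈ Finset.range n, hankelWeight F n k * PowerSeries.coeff k (φ * ψ) =
      ∑ x ∈ Finset.range n ×ˢ Finset.range n, hankelWeight F n (x.1 + x.2) *
        (PowerSeries.coeff x.1 φ * PowerSeries.coeff x.2 ψ) := by
  rw [Finset.sum_product]
  have hsub : ∀ j ∈ Finset.range n, ∑ l ∈ Finset.range n, hankelWeight F n (j + l) *
        (PowerSeries.coeff j φ * PowerSeries.coeff l ψ) =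
      ∑ l ∈ Finset.range (n - j), hankelWeight F n (j + l) *
        (PowerSeries.coeff j φ * PowerSeries.coeff l ψ) := fun j _ => by
    refine (Finset.sum_subset (Finset.range_mono (Nat.sub_le n j)) fun l _ hl => ?_).symm
    have : n - (j + l) = 0 := by
      rw [Finset.mem_range] at hl
      omega
    simp [hankelWeight, this]
  rw [Finset.sum_congr rfl hsub, ← Finset.sum_range_diag_flip]
  refine Finset.sum_congr rfl fun s _ => ?_
  rw [coeff_mul_range, Finset.mul_sum]
  refine Finset.sum_congr rfl fun k hk => ?_
  rw [Nat.add_sub_cancel' (Nat.lt_succ_iff.1 (Finset.mem_range.1 hk))]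

/-- The Schur test for the Hankel form with eigenvector `F`. -/
lemma sum_hankelWeight_le {F : ℝ⟦X⟧} (hF : F ^ 2 * (1 - PowerSeries.X) = 1)
    (h0 : PowerSeries.coeff 0 F = 1) (φ ψ : ℝ⟦X⟧) (n : ℕ) :
    ∑ x ∈ Finset.range n ×ˢ Finset.range n, hankelWeight F n (x.1 + x.2) *
        (PowerSeries.coeff x.1 φ * PowerSeries.coeff x.2 ψ) ≤ coeffNorm φ n * coeffNorm ψ n := by
  have hpos := coeff_pos_of_sq_mul hF h0
  have hw := hankelWeight_nonneg hF h0 n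
  have hrow : ∀ χ : ℝ⟦X⟧, ∑ x ∈ Finset.range n ×ˢ Finset.range n,
      (√(hankelWeight F n (x.1 + x.2) * (PowerSeries.coeff x.2 F / PowerSeries.coeff x.1 F)) *
        PowerSeries.coeff x.1 χ) ^ 2 =
      ∑ k ∈ Finset.range n, PowerSeries.coeff k χ ^ 2 := fun χ => by
    rw [Finset.sum_product]
    refine Finset.sum_congr rfl fun j hj => ?_
    have hj0 := (hpos j).ne'
    calc _ = ∑ l ∈ Finset.range n, PowerSeries.coeff j χ ^ 2 / PowerSeries.coeff j F *
          (hankelWeight F n (j + l) * PowerSeries.coeff l F) := by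
          refine Finset.sum_congr rfl fun l _ => ?_
          rw [mul_pow, Real.sq_sqrt (mul_nonneg (hw _) (div_nonneg (hpos _).le (hpos _).le))]
          ring
      _ = _ := by
          rw [← Finset.mul_sum, sum_hankelWeight_mul hF (Finset.mem_range.1 hj),
            div_mul_cancel₀ _ hj0]
  have hcol : ∑ x ∈ Finset.range n ×ˢ Finset.range n,
      (√(hankelWeight F n (x.1 + x.2) * (PowerSeries.coeff x.1 F / PowerSeries.coeff x.2 F)) *
        PowerSeries.coeff x.2 ψ) ^ 2 =
      ∑ k ∈ Finset.range n, PowerSeries.coeff k ψ ^ 2 := by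
    rw [← hrow ψ, Finset.sum_product, Finset.sum_comm, ← Finset.sum_product']
    simp_rw [add_comm]
  -- Cauchy–Schwarz with the weight split as `√(w F_l/F_j) · √(w F_j/F_l)`; the eigenvector equation
  -- evaluates both square sums.
  have hcs := Real.sum_mul_le_sqrt_mul_sqrt (Finset.range n ×ˢ Finset.range n)
    (fun x => √(hankelWeight F n (x.1 + x.2) *
      (PowerSeries.coeff x.2 F / PowerSeries.coeff x.1 F)) * PowerSeries.coeff x.1 φ)
    (fun x => √(hankelWeight F n (x.1 + x.2) *
      (PowerSeries.coeff x.1 F / PowerSeries.coeff x.2 F)) * PowerSeries.coeff x.2 ψ)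
  rw [hrow, hcol] at hcs
  refine le_of_eq_of_le (Finset.sum_congr rfl fun x _ => ?_) hcs
  have h1 := (hpos x.1).ne'
  have h2 := (hpos x.2).ne'
  rw [mul_mul_mul_comm, ← Real.sqrt_mul (mul_nonneg (hw _) (div_nonneg (hpos _).le (hpos _).le)),
    show hankelWeight F n (x.1 + x.2) * (PowerSeries.coeff x.2 F / PowerSeries.coeff x.1 F) *
      (hankelWeight F n (x.1 + x.2) * (PowerSeries.coeff x.1 F / PowerSeries.coeff x.2 F)) =
      hankelWeight F n (x.1 + x.2) ^ 2 by field_simp, Real.sqrt_sq (hw _)]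

lemma coeffNorm_mul_self_le {F : ℝ⟦X⟧} (hF : F ^ 2 * (1 - PowerSeries.X) = 1)
    (h0 : PowerSeries.coeff 0 F = 1) (φ ψ : ℝ⟦X⟧) (n : ℕ)
    (h : ∀ k < n, PowerSeries.coeff k (φ * ψ) = PowerSeries.coeff k (F * F)) :
    coeffNorm F n * coeffNorm F n ≤ coeffNorm φ n * coeffNorm ψ n := by
  refine le_of_eq_of_le ?_ (sum_hankelWeight_le hF h0 φ ψ n)
  rw [← sum_hankelWeight_mul_mul, Finset.sum_congr rfl fun k hk => by
    rw [h k (Finset.mem_range.1 hk)], sum_hankelWeight_mul_mul, coeffNorm,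
    Real.mul_self_sqrt (Finset.sum_nonneg fun _ _ => sq_nonneg _), Finset.sum_product]
  refine Finset.sum_congr rfl fun j hj => ?_
  rw [pow_two]
  nth_rewrite 1 [← sum_hankelWeight_mul hF (Finset.mem_range.1 hj)]
  rw [Finset.sum_mul]
  exact Finset.sum_congr rfl fun l _ => by ring

lemma coeff_eq_of_genMatrix_eq {φ ψ : ℝ⟦X⟧} {n : ℕ} (h : genMatrix φ n = genMatrix ψ n) {k : ℕ}
    (hk : k < n) : PowerSeries.coeff k φ = PowerSeries.coeff k ψ := by
  have := congrFun (congrFun h ⟨k, hk⟩) ⟨0, by omega⟩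
  simpa [genMatrix] using this

theorem genMatrix_optimal {F : ℝ⟦X⟧} (hF : F ^ 2 * (1 - PowerSeries.X) = 1)
    (h0 : PowerSeries.coeff 0 F = 1) {n : ℕ} (hn : 0 < n) :
    IsLTToeplitz (genMatrix F n) ∧ genMatrix F n * genMatrix F n = onesLT n ∧
      ∀ B' C' : Matrix (Fin n) (Fin n) ℝ, IsLTToeplitz B' → IsLTToeplitz C' →
        B' * C' = onesLT n →
        rowNorm (genMatrix F n) * colNorm (genMatrix F n) ≤ rowNorm B' * colNorm C' := by
  have hFF : genMatrix F n * genMatrix F n = onesLT n := by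
    rw [genMatrix_mul, ← genMatrix_geometric]
    congr 1
    rw [PowerSeries.eq_inv_iff_mul_eq_one (by simp)]
    linear_combination hF
  refine ⟨isLTToeplitz_genMatrix _ _, hFF, fun B' C' hB hC hBC => ?_⟩
  obtain ⟨φ, rfl⟩ := hB.exists_eq_genMatrix
  obtain ⟨ψ, rfl⟩ := hC.exists_eq_genMatrix
  simp only [rowNorm_genMatrix _ hn, colNorm_genMatrix _ hn]
  rw [← hFF, genMatrix_mul, genMatrix_mul] at hBC
  exact coeffNorm_mul_self_le hF h0 φ ψ n fun k hk => coeff_eq_of_genMatrix_eq hBC hk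

/-! ### Linear recursive filters -/

/-- The registers of the linear filter with feed-forward coefficients `p` and feedback
coefficients `c`, driven by the input `z` (transposed direct form). -/
noncomputable def filterState (p c z : ℕ → ℝ) : ℕ → ℕ → ℝ
  | 0, _ => 0
  | k + 1, i => p i * z k + c i * (p 0 * z k + filterState p c z k 1) + filterState p c z k (i + 1)

lemma filterState_succ_zero {p c : ℕ → ℝ} (hc : c 0 = 0) (z : ℕ → ℝ) (k : ℕ) :
    filterState p c z (k + 1) 0 = p 0 * z k + filterState p c z k 1 := by
  simp [filterState, hc]

lemma filterState_succ {p c : ℕ → ℝ} (hc : c 0 = 0) (z : ℕ → ℝ) (k i : ℕ) :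
    filterState p c z (k + 1) i =
      p i * z k + c i * filterState p c z (k + 1) 0 + filterState p c z k (i + 1) := by
  rw [filterState_succ_zero hc, filterState]

lemma filterState_eq_zero {p c : ℕ → ℝ} {d : ℕ} (hp : ∀ i, d ≤ i → p i = 0)
    (hc : ∀ i, d ≤ i → c i = 0) (z : ℕ → ℝ) (k : ℕ) {i : ℕ} (hi : d ≤ i) :
    filterState p c z k i = 0 := by
  induction k generalizing i with
  | zero => rfl
  | succ k ih => rw [filterState, hp i hi, hc i hi, ih (hi.trans (Nat.le_succ i))]; ring

/-- What enters register `i + (k - j)` at time `j` is shifted down one place per step and reaches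
register `i` at time `k`. -/
lemma filterState_succ_eq_sum {p c : ℕ → ℝ} (hc : c 0 = 0) (z : ℕ → ℝ) (k i : ℕ) :
    filterState p c z (k + 1) i = ∑ j ∈ Finset.range (k + 1),
      (p (i + (k - j)) * z j + c (i + (k - j)) * filterState p c z (j + 1) 0) := by
  induction k generalizing i with
  | zero => rw [filterState_succ hc]; simp [filterState]
  | succ k ih =>
    rw [filterState_succ hc, Finset.sum_range_succ, ih, add_comm]
    congr 1
    · refine Finset.sum_congr rfl fun j hj => ?_
      rw [show i + 1 + (k - j) = i + (k + 1 - j) by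
        have := Finset.mem_range.1 hj
        omega]
    · simp

/-- The feedback coefficients of the filter with transfer function `p / q`. -/
noncomputable def feedback (q : ℝ[X]) (i : ℕ) : ℝ := if i = 0 then 0 else -q.coeff i

/-- As generating functions, the output `Y` and the input `Z` satisfy `Y = Z p + Y (1 - q)`, hence
`Y = Z p / q`. -/
lemma filterState_eq_sum_coeff {p q : ℝ[X]} (hq : q.coeff 0 = 1) (z : ℕ → ℝ) (k : ℕ) :
    filterState p.coeff (feedback q) z (k + 1) 0 = ∑ j ∈ Finset.range (k + 1),
      PowerSeries.coeff (k - j) ((p : ℝ⟦X⟧) * (q : ℝ⟦X⟧)⁻¹) * z j := by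
  set Y : ℝ⟦X⟧ := PowerSeries.mk fun k => filterState p.coeff (feedback q) z (k + 1) 0 with hY
  set Z : ℝ⟦X⟧ := PowerSeries.mk z with hZ
  have hfb : PowerSeries.mk (feedback q) = 1 - (q : ℝ⟦X⟧) := by
    ext i
    rcases i with _ | i <;> simp [feedback, PowerSeries.coeff_one, hq]
  have h1 : Y = Z * (p : ℝ⟦X⟧) + Y * (1 - (q : ℝ⟦X⟧)) := by
    ext k
    rw [map_add, coeff_mul_range, coeff_mul_range, ← hfb, ← Finset.sum_add_distrib, hY,
      PowerSeries.coeff_mk, filterState_succ_eq_sum (by simp [feedback])]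
    refine Finset.sum_congr rfl fun j _ => ?_
    simp only [hZ, PowerSeries.coeff_mk, Polynomial.coeff_coe, zero_add]
    ring
  have h2 : Y = Z * ((p : ℝ⟦X⟧) * (q : ℝ⟦X⟧)⁻¹) := by
    rw [← mul_assoc, PowerSeries.eq_mul_inv_iff_mul_eq (by simp [hq])]
    linear_combination h1
  have h3 := congrArg (PowerSeries.coeff k) h2
  rw [coeff_mul_range, hY, PowerSeries.coeff_mk] at h3
  rw [h3]
  exact Finset.sum_congr rfl fun j _ => by rw [hZ, PowerSeries.coeff_mk, mul_comm]

lemma genMatrix_mul_streamMatrix_apply {p q : ℝ[X]} (hq : q.coeff 0 = 1) {m n : ℕ}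
    (z : ℕ → Fin m → ℝ) (k : Fin n) (l : Fin m) :
    (genMatrix ((p : ℝ⟦X⟧) * (q : ℝ⟦X⟧)⁻¹) n * streamMatrix n z) k l =
      filterState p.coeff (feedback q) (fun k => z k l) (k + 1) 0 := by
  rw [filterState_eq_sum_coeff hq, ← genMatrix_mulVec_apply]
  rfl

lemma feedback_eq_zero {q : ℝ[X]} {d : ℕ} (hq : q.natDegree < d) (i : ℕ) (hi : d ≤ i) :
    feedback q i = 0 := by
  rw [feedback, if_neg (by omega), Polynomial.coeff_eq_zero_of_natDegree_lt (by omega), neg_zero]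

/-- Substituting the output `p₀ z + s₁` into the feedback term removes it: register `i` then depends
only on the input and on registers 1 and `i + 1`. Registers from `d` on are zero, so truncating the
matrix loses nothing. -/
lemma bltState_eq_filterState {p c : ℕ → ℝ} {d : ℕ} (hp : ∀ i, d ≤ i → p i = 0)
    (hc : ∀ i, d ≤ i → c i = 0) {m : ℕ} (z : ℕ → Fin m → ℝ) (k : ℕ) (i : Fin d) (l : Fin m) :
    bltState (Matrix.of fun i j : Fin d => (if (j : ℕ) = 1 then c i else 0) +
        (if (j : ℕ) = i + 1 then (1 : ℝ) else 0)) (fun i => p i + c i * p 0) z k i l =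
      filterState p c (fun k => z k l) k i := by
  induction k generalizing i with
  | zero => rfl
  | succ k ih =>
    rw [bltState, filterState, Matrix.add_apply, Matrix.vecMulVec_apply, Matrix.mul_apply]
    simp only [ih, Matrix.of_apply]
    rw [Fin.sum_univ_eq_sum_range (fun j => ((if j = 1 then c i else 0) +
      (if j = (i : ℕ) + 1 then (1 : ℝ) else 0)) * filterState p c (fun k => z k l) k j)]
    simp only [add_mul, ite_mul, zero_mul, one_mul, Finset.sum_add_distrib, Finset.sum_ite_eq',
      Finset.mem_range]
    have hz := fun i => @filterState_eq_zero p c d hp hc (fun k => z k l) k i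
    have e1 : (if 1 < d then c i * filterState p c (fun k => z k l) k 1 else 0) =
        c i * filterState p c (fun k => z k l) k 1 := by
      split_ifs with h
      · rfl
      · rw [hz 1 (by omega), mul_zero]
    have e2 : (if (i : ℕ) + 1 < d then filterState p c (fun k => z k l) k (i + 1) else 0) =
        filterState p c (fun k => z k l) k (i + 1) := by
      split_ifs with h
      · rfl
      · rw [hz _ (by omega)]
    rw [e1, e2]
    ring

theorem hasBLTRecurrence_genMatrix {p q : ℝ[X]} {d : ℕ} (hp : p.natDegree < d)
    (hqd : q.natDegree < d) (hq : q.coeff 0 = 1) (n : ℕ) :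
    HasBLTRecurrence d (genMatrix ((p : ℝ⟦X⟧) * (q : ℝ⟦X⟧)⁻¹) n) := by
  -- After the update register 0 already holds the current output, so `u` selects it and the direct
  -- term `t` is 0.
  refine ⟨Pi.single ⟨0, by omega⟩ 1, fun i => p.coeff i + feedback q i * p.coeff 0,
    Matrix.of fun i j : Fin d => (if (j : ℕ) = 1 then feedback q i else 0) +
      (if (j : ℕ) = i + 1 then (1 : ℝ) else 0), 0, fun i => ?_, fun m z k => ?_⟩
  rotate_left
  · funext l
    rw [genMatrix_mul_streamMatrix_apply hq, bltOutput, zero_smul, zero_add,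
      Matrix.single_one_vecMul]
    exact bltState_eq_filterState (p := p.coeff)
      (fun i hi => Polynomial.coeff_eq_zero_of_natDegree_lt (by omega))
      (feedback_eq_zero hqd) z (k + 1) ⟨0, by omega⟩ l
  · refine le_trans ?_ ((Set.ncard_insert_le 1 {(i : ℕ) + 1}).trans_eq (by simp))
    refine Set.ncard_le_ncard_of_injOn (fun j : Fin d => (j : ℕ)) (fun j hj => ?_)
      Fin.val_injective.injOn (Set.toFinite _)
    by_contra h
    simp only [Set.mem_insert_iff, Set.mem_singleton_iff, not_or] at h
    simp [h.1, h.2] at hj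

/-! ### A streaming program for linear recursive filters -/

namespace MState
variable {r S : ℕ}

@[simp] lemma read_setIdx (s : MState r S) (x : Fin r) (c a : ℕ) :
    (s.setIdx x c).read a = s.read a := rfl

@[simp] lemma idx_write (s : MState r S) (a : ℕ) (c : ℝ) : (s.write a c).idx = s.idx := rfl

lemma read_write_self (s : MState r S) {a : ℕ} (ha : a < S) (c : ℝ) :
    (s.write a c).read a = c := by simp [read, write, ha]

lemma read_write_of_ne (s : MState r S) {a b : ℕ} (h : b ≠ a) (c : ℝ) :
    (s.write a c).read b = s.read b := by simp [read, write, h]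

end MState

lemma exec_loop {r S : ℕ} {I : ℕ → MState r S → Prop} {c N : ℕ} {x : Fin r} {p : Prog r}
    {s : MState r S} (hN : s.idx x = N) (h0 : I 0 s)
    (hs : ∀ k < N, ∀ s, I k s → I (k + 1) (p.exec s).1 ∧ (p.exec s).2 ≤ c) :
    I N ((Prog.loop x p).exec s).1 ∧ ((Prog.loop x p).exec s).2 ≤ 1 + N * (1 + c) := by
  rw [Prog.exec, hN]
  have key : ∀ k ≤ N,
      I k ((fun q : MState r S × ℕ => ((p.exec q.1).1, q.2 + 1 + (p.exec q.1).2))^[k] (s, 1)).1 ∧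
      ((fun q : MState r S × ℕ => ((p.exec q.1).1, q.2 + 1 + (p.exec q.1).2))^[k] (s, 1)).2 ≤
        1 + k * (1 + c) := by
    intro k
    induction k with
    | zero => intro _; simpa using h0
    | succ k ih =>
      intro hk
      obtain ⟨h1, h2⟩ := ih (by omega)
      obtain ⟨h3, h4⟩ := hs k (by omega) _ h1
      rw [Function.iterate_succ_apply']
      refine ⟨h3, ?_⟩
      dsimp only
      rw [add_mul]
      omega
  exact key N le_rfl

/-- `mem[4] := mem[5] + mem[9] * mem[7] + mem[8] * mem[6]`, with scratch cell `3`. -/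
def accumulateProg : Prog 10 :=
  .seq (.rmul 3 9 7) (.seq (.radd 4 5 3) (.seq (.rmul 3 8 6) (.radd 4 4 3)))

/-- Advance the pointers `4`, …, `7`. -/
def advanceProg : Prog 10 :=
  .seq (.iadd 4 4 2) (.seq (.iadd 5 5 2) (.seq (.iadd 6 6 2) (.iadd 7 7 2)))

/-- Update one register of the filter in all columns. -/
def filterRowProg : Prog 10 :=
  .seq (.loop 1 (.seq accumulateProg advanceProg))
    (.seq (.iconst 6 0) (.seq (.iadd 7 1 6) (.seq (.iadd 8 8 2) (.iadd 9 9 2))))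

/-- Set the pointers to their initial positions. -/
def filterInitProg : Prog 10 :=
  .seq (.iconst 2 1) (.seq (.iconst 6 0) (.seq (.iadd 7 1 6) (.seq (.iadd 4 1 6)
    (.seq (.iadd 5 1 1) (.seq (.imul 3 0 1) (.seq (.iadd 3 3 5)
      (.seq (.iadd 8 3 2) (.iadd 9 8 0))))))))

/-- One time step of the linear filter. -/
def filterProg : Prog 10 :=
  .seq filterInitProg (.loop 0 filterRowProg)

lemma read_exec_accumulateProg {S : ℕ} (s : MState 10 S) (h3 : s.idx 3 < S) (h4 : s.idx 4 < S)
    (h34 : s.idx 3 ≠ s.idx 4) (h53 : s.idx 5 ≠ s.idx 3)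
    (h83 : s.idx 8 ≠ s.idx 3) (h84 : s.idx 8 ≠ s.idx 4) (h63 : s.idx 6 ≠ s.idx 3)
    (h64 : s.idx 6 ≠ s.idx 4) {b : ℕ} (hb : b ≠ s.idx 3) :
    (accumulateProg.exec s).1.read b =
      if b = s.idx 4 then s.read (s.idx 5) + s.read (s.idx 9) * s.read (s.idx 7) +
        s.read (s.idx 8) * s.read (s.idx 6) else s.read b := by
  simp only [accumulateProg, Prog.exec, MState.idx_write]
  split_ifs with h
  · rw [h, MState.read_write_self _ h4, MState.read_write_self _ h3,
      MState.read_write_of_ne _ h34.symm, MState.read_write_self _ h4,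
      MState.read_write_self _ h3, MState.read_write_of_ne _ h53,
      MState.read_write_of_ne _ h84, MState.read_write_of_ne _ h83,
      MState.read_write_of_ne _ h64, MState.read_write_of_ne _ h63]
  · rw [MState.read_write_of_ne _ h, MState.read_write_of_ne _ hb,
      MState.read_write_of_ne _ h, MState.read_write_of_ne _ hb]

/-- The state of the filter program before processing column `l` of register `i`. -/
structure FilterInv {S : ℕ} (d m : ℕ) (p c z new old : ℕ → ℝ) (i l : ℕ) (s : MState 10 S) :
    Prop where
  -- Memory layout: `m` input cells, then `d + 1` rows of `m` cells for the registers (the last row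
  -- is always zero), one scratch cell, and the coefficients of `p` and of the feedback.
  idx : s.idx = ![d, m, 1, d * m + 2 * m, m + (i * m + l), 2 * m + (i * m + l), l, m + l,
    d * m + 2 * m + 1 + i, d * m + 2 * m + 1 + d + i]
  input : ∀ a < m, s.read a = z a
  forward : ∀ a < d, s.read (d * m + 2 * m + 1 + a) = p a
  back : ∀ a < d, s.read (d * m + 2 * m + 1 + d + a) = c a
  done : ∀ j < i * m + l, s.read (m + j) = new j
  todo : ∀ j, i * m + l ≤ j → j < d * m + m → s.read (m + j) = old j

/-- Updating in place is sound: the cell read from row `i + 1` is still old, while for `i > 0` the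
output in row 0 is already new. -/
lemma FilterInv.step {S d m : ℕ} (hS : d * m + 2 * m < S) {p c z new old : ℕ → ℝ}
    (hc : c 0 = 0) (hnew : ∀ i < d, ∀ l < m, new (i * m + l) =
      p i * z l + c i * new l + old (i * m + l + m)) {i l : ℕ} (hi : i < d) (hl : l < m)
    {s : MState 10 S} (h : FilterInv d m p c z new old i l s) :
    FilterInv d m p c z new old i (l + 1) ((Prog.seq accumulateProg advanceProg).exec s).1 := by
  have hidx := h.idx
  have i3 : s.idx 3 = d * m + 2 * m := by rw [hidx]; rfl
  have i4 : s.idx 4 = m + (i * m + l) := by rw [hidx]; rfl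
  have i5 : s.idx 5 = 2 * m + (i * m + l) := by rw [hidx]; rfl
  have i6 : s.idx 6 = l := by rw [hidx]; rfl
  have i7 : s.idx 7 = m + l := by rw [hidx]; rfl
  have i8 : s.idx 8 = d * m + 2 * m + 1 + i := by rw [hidx]; rfl
  have i9 : s.idx 9 = d * m + 2 * m + 1 + d + i := by rw [hidx]; rfl
  have him : i * m + m ≤ d * m := by
    have := Nat.mul_le_mul_right m hi
    rwa [Nat.succ_mul] at this
  have hread : ∀ b, b ≠ d * m + 2 * m →
      ((Prog.seq accumulateProg advanceProg).exec s).1.read b =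
      if b = m + (i * m + l) then new (i * m + l) else s.read b := by
    intro b hb
    have := read_exec_accumulateProg s (by omega) (by omega) (by omega) (by omega) (by omega)
      (by omega) (by omega) (by omega) (b := b) (by omega)
    simp only [Prog.exec, advanceProg, MState.read_setIdx]
    rw [this, i4, i5, i6, i7, i8, i9, h.input l hl, h.forward i hi, h.back i hi,
      show 2 * m + (i * m + l) = m + (i * m + l + m) by omega,
      h.todo (i * m + l + m) (by omega) (by omega), hnew i hi l hl]
    -- For `i = 0` the output cell is still the old one, but the factor `c 0 = 0` cancels it.
    have hy : c i * s.read (m + l) = c i * new l := by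
      rcases Nat.eq_zero_or_pos i with rfl | hi0
      · simp [hc]
      · have : 0 < i * m := Nat.mul_pos hi0 (by omega)
        rw [h.done l (by omega)]
    rw [hy]
    congr 1
    ring
  refine ⟨?_, fun a ha => ?_, fun a ha => ?_, fun a ha => ?_, fun j hj => ?_, fun j hj hj' => ?_⟩
  · simp only [Prog.exec, accumulateProg, advanceProg, MState.setIdx, MState.idx_write, hidx]
    funext x
    fin_cases x <;> simp [add_assoc]
  · rw [hread _ (by omega), if_neg (by omega), h.input a ha]
  · rw [hread _ (by omega), if_neg (by omega), h.forward a ha]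
  · rw [hread _ (by omega), if_neg (by omega), h.back a ha]
  · rw [hread _ (by omega)]
    by_cases hj1 : j = i * m + l
    · rw [hj1, if_pos rfl]
    · rw [if_neg (by omega), h.done j (by omega)]
  · rw [hread _ (by omega), if_neg (by omega), h.todo j (by omega) hj']

lemma FilterInv.row {S d m : ℕ} (hS : d * m + 2 * m < S) {p c z new old : ℕ → ℝ}
    (hc : c 0 = 0) (hnew : ∀ i < d, ∀ l < m, new (i * m + l) =
      p i * z l + c i * new l + old (i * m + l + m)) {i : ℕ} (hi : i < d)
    {s : MState 10 S} (h : FilterInv d m p c z new old i 0 s) :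
    FilterInv d m p c z new old (i + 1) 0 (filterRowProg.exec s).1 ∧
      (filterRowProg.exec s).2 ≤ 5 + 9 * m := by
  obtain ⟨h1, h2⟩ := exec_loop (I := fun l => FilterInv d m p c z new old i l) (c := 8) (x := 1)
    (p := .seq accumulateProg advanceProg) (by rw [h.idx]; rfl) h
    fun l hl s h => ⟨h.step hS hc hnew hi hl, le_rfl⟩
  refine ⟨?_, ?_⟩
  · set s' := ((Prog.loop 1 (.seq accumulateProg advanceProg)).exec s).1 with hs'
    have hidx := h1.idx
    have hread : ∀ b, (filterRowProg.exec s).1.read b = s'.read b := fun b => by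
      simp only [filterRowProg, Prog.exec.eq_8, ← hs']
      rfl
    have him : (i + 1) * m + 0 = i * m + m := by ring
    refine ⟨?_, fun a ha => ?_, fun a ha => ?_, fun a ha => ?_, fun j hj => ?_,
      fun j hj hj' => ?_⟩
    · simp only [filterRowProg, Prog.exec.eq_8, ← hs']
      simp only [Prog.exec, MState.setIdx, hidx, him]
      funext x
      fin_cases x <;> simp [add_assoc]
    · rw [hread, h1.input a ha]
    · rw [hread, h1.forward a ha]
    · rw [hread, h1.back a ha]
    · rw [hread, h1.done j (by omega)]
    · rw [hread, h1.todo j (by omega) hj']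
  · have : (filterRowProg.exec s).2 =
        ((Prog.loop 1 (.seq accumulateProg advanceProg)).exec s).2 + 4 := rfl
    omega

/-- The state of the filter program between two time steps. -/
structure FilterReady {S : ℕ} (d m : ℕ) (p c t : ℕ → ℝ) (s : MState 10 S) : Prop where
  idx_zero : s.idx 0 = d
  idx_one : s.idx 1 = m
  forward : ∀ a < d, s.read (d * m + 2 * m + 1 + a) = p a
  back : ∀ a < d, s.read (d * m + 2 * m + 1 + d + a) = c a
  state : ∀ j < d * m + m, s.read (m + j) = t j

lemma MState.read_load {r S m : ℕ} (hm : m ≤ S) (s : MState r S) (row : Fin m → ℝ) (b : ℕ) :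
    (s.load row).read b = if h : b < m then row ⟨b, h⟩ else s.read b := by
  by_cases h : b < m
  · simp [read, load, h, h.trans_le hm]
  · simp [read, load, h]

lemma FilterReady.step {S d m : ℕ} (hS : d * m + 2 * m < S) {p c new old : ℕ → ℝ}
    {row : Fin m → ℝ} {z : ℕ → ℝ} (hz : ∀ l : Fin m, z l = row l)
    (hc : c 0 = 0) (hnew : ∀ i < d, ∀ l < m, new (i * m + l) =
      p i * z l + c i * new l + old (i * m + l + m))
    (hlast : ∀ j, d * m ≤ j → j < d * m + m → new j = old j)
    {s : MState 10 S} (h : FilterReady d m p c old s) :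
    FilterReady d m p c new (filterProg.exec (s.load row)).1 ∧
      (filterProg.exec (s.load row)).2 ≤ 10 + d * (6 + 9 * m) := by
  set s' := (filterInitProg.exec (s.load row)).1 with hs'
  have hread : ∀ b, s'.read b = if h : b < m then row ⟨b, h⟩ else s.read b := fun b => by
    rw [← MState.read_load (by omega)]
    rfl
  have h0 : (s.load row).idx 0 = d := h.idx_zero
  have h1 : (s.load row).idx 1 = m := h.idx_one
  have hinv : FilterInv d m p c z new old 0 0 s' := by
    refine ⟨?_, fun a ha => ?_, fun a ha => ?_, fun a ha => ?_, fun j hj => ?_,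
      fun j hj hj' => ?_⟩
    · simp only [hs', filterInitProg, Prog.exec, MState.setIdx]
      funext x
      fin_cases x <;> simp [h0, h1, add_assoc, two_mul]
    · rw [hread, dif_pos ha, ← hz]
    · rw [hread, dif_neg (by omega), h.forward a ha]
    · rw [hread, dif_neg (by omega), h.back a ha]
    · omega
    · rw [hread, dif_neg (by omega), h.state j hj']
  obtain ⟨h2, h3⟩ := exec_loop (I := fun i => FilterInv d m p c z new old i 0)
    (c := 5 + 9 * m) (x := 0) (p := filterRowProg) (by rw [hinv.idx]; rfl) hinv
    fun i hi s h => h.row hS hc hnew hi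
  refine ⟨⟨?_, ?_, h2.forward, h2.back, fun j hj => ?_⟩, ?_⟩
  · change ((Prog.loop 0 filterRowProg).exec s').1.idx 0 = d
    rw [h2.idx]
    rfl
  · change ((Prog.loop 0 filterRowProg).exec s').1.idx 1 = m
    rw [h2.idx]
    rfl
  · change ((Prog.loop 0 filterRowProg).exec s').1.read (m + j) = new j
    by_cases hjd : j < d * m
    · exact h2.done j hjd
    · rw [h2.todo j (by omega) hj, hlast j (by omega) hj]
  · have : (filterProg.exec (s.load row)).2 = 9 + ((Prog.loop 0 filterRowProg).exec s').2 := rfl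
    rw [this, show 6 + 9 * m = 1 + (5 + 9 * m) by ring]
    omega

/-- The initial memory of the filter program: `0` in the cells for input and registers and the
scratch cell, followed by the two lists of coefficients. -/
def filterParams (d m : ℕ) (p c : ℕ → ℝ) (a : ℕ) : ℝ :=
  if a < d * m + 2 * m + 1 then 0
  else if a < d * m + 2 * m + 1 + d then p (a - (d * m + 2 * m + 1))
  else c (a - (d * m + 2 * m + 1 + d))

/-- Row 0 of the registers occupies exactly the output cells. The constant is `27 = 10 + 6 + 9 + 2`,
from the time `10 + 6 d + 9 d m + 2 m` and `1 ≤ d`, `1 ≤ m`. -/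
theorem filterProg_streamsWithin {p q : ℝ[X]} {d : ℕ} (hp : p.natDegree < d)
    (hqd : q.natDegree < d) (hq : q.coeff 0 = 1) (n : ℕ) {m : ℕ} (hm : 1 ≤ m) :
    filterProg.StreamsWithin d m (genMatrix ((p : ℝ⟦X⟧) * (q : ℝ⟦X⟧)⁻¹) n) (27 * (d * m)) := by
  have hd : 1 ≤ d := by omega
  have hdm : d ≤ d * m := Nat.le_mul_of_pos_right d hm
  have hmd : m ≤ d * m := Nat.le_mul_of_pos_left m hd
  set S := d * m + 2 * m + 1 + d + d with hS
  refine ⟨S, fun a => filterParams d m p.coeff (feedback q) a, by omega, fun z k => ?_⟩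
  have hp0 : ∀ i, d ≤ i → p.coeff i = 0 :=
    fun i hi => Polynomial.coeff_eq_zero_of_natDegree_lt (by omega)
  have hq0 := feedback_eq_zero hqd
  have hc0 : feedback q 0 = 0 := by simp [feedback]
  let w : ℕ → ℕ → ℝ := fun l k => if h : l < m then z k ⟨l, h⟩ else 0
  have hw : ∀ k, ∀ l : Fin m, w l k = z k l := fun k l => by simp [w]
  -- The filters of the `m` columns are stored row by row: position `j` is register `j / m` of
  -- column `j % m`.
  let t : ℕ → ℕ → ℝ := fun k j => filterState p.coeff (feedback q) (w (j % m)) k (j / m)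
  have ht : ∀ k i l, l < m → t k (i * m + l) = filterState p.coeff (feedback q) (w l) k i :=
    fun k i l hl => by
      simp only [t]
      rw [mul_comm, Nat.mul_add_mod, Nat.mod_eq_of_lt hl, Nat.mul_add_div (by omega),
        Nat.div_eq_of_lt hl, add_zero]
  have hstep : ∀ k (s : MState 10 S), FilterReady d m p.coeff (feedback q) (t k) s →
      FilterReady d m p.coeff (feedback q) (t (k + 1)) (filterProg.exec (s.load (z k))).1 ∧
      (filterProg.exec (s.load (z k))).2 ≤ 10 + d * (6 + 9 * m) := fun k s h => by
    refine FilterReady.step (z := fun l => w l k) (by omega) (hw k) hc0 (fun i hi l hl => ?_)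
      (fun j hj _ => ?_) h
    · have h1 := ht (k + 1) 0 l hl
      rw [zero_mul, zero_add] at h1
      rw [show i * m + l + m = (i + 1) * m + l by ring, ht _ _ _ hl, ht _ _ _ hl, h1,
        filterState_succ hc0]
    · have : d ≤ j / m := (Nat.le_div_iff_mul_le (by omega)).2 hj
      simp only [t]
      rw [filterState_eq_zero hp0 hq0 _ _ this, filterState_eq_zero hp0 hq0 _ _ this]
  have hready : ∀ k, FilterReady d m p.coeff (feedback q) (t k)
      (filterProg.stateAfter d (fun a : Fin S => filterParams d m p.coeff (feedback q) a) z k) := by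
    intro k
    induction k with
    | zero =>
      refine ⟨rfl, rfl, fun a ha => ?_, fun a ha => ?_, fun j hj => ?_⟩
      · simp only [Prog.stateAfter, MState.init, MState.read, filterParams]
        rw [dif_pos (by omega), if_neg (by omega), if_pos (by omega), Nat.add_sub_cancel_left]
      · simp only [Prog.stateAfter, MState.init, MState.read, filterParams]
        rw [dif_pos (by omega), if_neg (by omega), if_neg (by omega), Nat.add_sub_cancel_left]
      · simp only [Prog.stateAfter, MState.init, MState.read, filterParams]
        rw [dif_pos (by omega), if_pos (by omega)]
        rfl
    | succ k ih => exact (hstep k _ ih).1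
  refine ⟨?_, ?_⟩
  · funext l
    have h1 := ht (k + 1) 0 l l.2
    rw [zero_mul, zero_add] at h1
    rw [genMatrix_mul_streamMatrix_apply hq, Prog.output,
      (hready (k + 1)).state l (by have := l.2; omega), h1]
    congr 1
    funext k
    exact hw k l
  · have := (hstep k _ (hready k)).2
    rw [Prog.iterTime]
    have e : d * (6 + 9 * m) = 6 * d + 9 * (d * m) := by ring
    omega

/-! ### Taylor series of smooth functions -/

section TaylorSeries
open scoped ContDiff

variable {𝕜 : Type*} [RCLike 𝕜]

/-- The formal Taylor series at `0` of a function. -/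
noncomputable def taylorPowerSeries (g : 𝕜 → 𝕜) : 𝕜⟦X⟧ :=
  PowerSeries.mk fun k => iteratedDeriv k g 0 / (Nat.factorial k : 𝕜)

lemma taylorPowerSeries_congr {f g : 𝕜 → 𝕜} (h : f =ᶠ[nhds 0] g) :
    taylorPowerSeries f = taylorPowerSeries g := by
  ext k
  simp [taylorPowerSeries, h.iteratedDeriv_eq k]

lemma taylorPowerSeries_mul {f g : 𝕜 → 𝕜} (hf : ContDiffAt 𝕜 ∞ f 0) (hg : ContDiffAt 𝕜 ∞ g 0) :
    taylorPowerSeries (f * g) = taylorPowerSeries f * taylorPowerSeries g := by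
  ext k
  rw [coeff_mul_range]
  simp only [taylorPowerSeries, PowerSeries.coeff_mk]
  rw [iteratedDeriv_mul (hf.of_le (by exact_mod_cast le_top)) (hg.of_le (by exact_mod_cast le_top)),
    Finset.sum_div]
  refine Finset.sum_congr rfl fun i hi => ?_
  have hi : i ≤ k := Nat.lt_succ_iff.1 (Finset.mem_range.1 hi)
  have h1 : (Nat.factorial i : 𝕜) ≠ 0 := Nat.cast_ne_zero.2 (Nat.factorial_ne_zero i)
  have h2 : (Nat.factorial (k - i) : 𝕜) ≠ 0 := Nat.cast_ne_zero.2 (Nat.factorial_ne_zero _)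
  have h3 : (Nat.factorial k : 𝕜) ≠ 0 := Nat.cast_ne_zero.2 (Nat.factorial_ne_zero _)
  rw [Nat.cast_choose 𝕜 hi]
  field_simp

lemma taylorPowerSeries_add {f g : 𝕜 → 𝕜} (hf : ContDiffAt 𝕜 ∞ f 0) (hg : ContDiffAt 𝕜 ∞ g 0) :
    taylorPowerSeries (f + g) = taylorPowerSeries f + taylorPowerSeries g := by
  ext k
  simp only [taylorPowerSeries, PowerSeries.coeff_mk, map_add]
  rw [iteratedDeriv_add (hf.of_le (by exact_mod_cast le_top))
    (hg.of_le (by exact_mod_cast le_top)), add_div]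

lemma taylorPowerSeries_sub {f g : 𝕜 → 𝕜} (hf : ContDiffAt 𝕜 ∞ f 0) (hg : ContDiffAt 𝕜 ∞ g 0) :
    taylorPowerSeries (f - g) = taylorPowerSeries f - taylorPowerSeries g := by
  ext k
  simp only [taylorPowerSeries, PowerSeries.coeff_mk, map_sub]
  rw [iteratedDeriv_sub (hf.of_le (by exact_mod_cast le_top))
    (hg.of_le (by exact_mod_cast le_top)), sub_div]

lemma taylorPowerSeries_aeval (P : ℝ[X]) :
    taylorPowerSeries (fun x : 𝕜 => Polynomial.aeval x P) =
      PowerSeries.map (algebraMap ℝ 𝕜) (P : ℝ⟦X⟧) := by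
  induction P using Polynomial.induction_on' with
  | add P Q hP hQ =>
    rw [Polynomial.coe_add, map_add, ← hP, ← hQ, ← taylorPowerSeries_add
      (Polynomial.contDiff_aeval P _).contDiffAt (Polynomial.contDiff_aeval Q _).contDiffAt]
    congr 1
    funext x
    simp
  | monomial n c =>
    ext k
    have hk : (Nat.factorial k : 𝕜) ≠ 0 := Nat.cast_ne_zero.2 (Nat.factorial_ne_zero k)
    simp only [taylorPowerSeries, PowerSeries.coeff_mk, Polynomial.aeval_monomial,
      iteratedDeriv_const_mul_field, iteratedDeriv_fun_pow_zero, PowerSeries.coeff_map,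
      Polynomial.coeff_coe, Polynomial.coeff_monomial]
    by_cases h : k = n
    · subst h
      simp [hk]
    · simp [h, Ne.symm h]

lemma taylorPowerSeries_one_sub :
    taylorPowerSeries (fun x : 𝕜 => 1 - x) = 1 - PowerSeries.X := by
  have := taylorPowerSeries_aeval (𝕜 := 𝕜) (1 - Polynomial.X)
  simpa using this

lemma taylorPowerSeries_one : taylorPowerSeries (1 : 𝕜 → 𝕜) = 1 := by
  have := taylorPowerSeries_aeval (𝕜 := 𝕜) 1
  simpa [Pi.one_def] using this

lemma taylorPowerSeries_sq_mul {f : 𝕜 → 𝕜} (hf : ContDiffAt 𝕜 ∞ f 0)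
    (h : ∀ᶠ x in nhds (0 : 𝕜), f x ^ 2 * (1 - x) = 1) :
    taylorPowerSeries f ^ 2 * (1 - PowerSeries.X) = 1 := by
  rw [pow_two, ← taylorPowerSeries_mul hf hf, ← taylorPowerSeries_one_sub,
    ← taylorPowerSeries_mul (f := f * f) (g := fun x => 1 - x) (hf.mul hf)
      (contDiffAt_const.sub contDiffAt_id), ← taylorPowerSeries_one]
  refine taylorPowerSeries_congr (h.mono fun x hx => ?_)
  simpa [pow_two] using hx

lemma coeff_zero_taylorPowerSeries (f : 𝕜 → 𝕜) :
    PowerSeries.coeff 0 (taylorPowerSeries f) = f 0 := by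
  simp [taylorPowerSeries]

end TaylorSeries

/-- Two square roots differ by a sign in a domain, and the constant term fixes the sign. This
identifies the Taylor series of the complex branch with the real series. -/
lemma eq_of_sq_mul_one_sub_X {K : Type*} [Field K] [CharZero K] {F G : K⟦X⟧}
    (hF : F ^ 2 * (1 - PowerSeries.X) = 1) (hG : G ^ 2 * (1 - PowerSeries.X) = 1)
    (hF0 : PowerSeries.coeff 0 F = 1) (hG0 : PowerSeries.coeff 0 G = 1) : F = G := by
  have hX : (1 - PowerSeries.X : K⟦X⟧) ≠ 0 := by
    intro h
    simp [h] at hF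
  have h : (F - G) * (F + G) * (1 - PowerSeries.X) = 0 := by linear_combination hF - hG
  rcases mul_eq_zero.1 ((mul_eq_zero.1 h).resolve_right hX) with h | h
  · exact sub_eq_zero.1 h
  · have := congrArg (PowerSeries.coeff 0) h
    rw [map_add, hF0, hG0, map_zero] at this
    norm_num at this

lemma taylorSeries_inv_sqrt :
    taylorSeries (fun x => 1 / √(1 - x)) ^ 2 * (1 - PowerSeries.X) = 1 ∧
      PowerSeries.coeff 0 (taylorSeries fun x => 1 / √(1 - x)) = 1 := by
  refine ⟨taylorPowerSeries_sq_mul (f := fun x : ℝ => 1 / √(1 - x)) ?_ ?_, ?_⟩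
  · refine contDiffAt_const.div (ContDiffAt.sqrt (contDiffAt_const.sub contDiffAt_id) ?_) ?_ <;>
      simp
  · filter_upwards [gt_mem_nhds (show (0 : ℝ) < 1 by norm_num)] with x hx
    have : 0 < 1 - x := sub_pos.2 hx
    rw [div_pow, Real.sq_sqrt this.le]
    field_simp
  · exact (coeff_zero_taylorPowerSeries _).trans (by simp)

/-! ### The complex square root of `1 - x` -/

/-- The principal branch of `√(1 - x)`. -/
noncomputable def sqrtOneSub (x : ℂ) : ℂ := (1 - x) ^ (((1 / 2 : ℝ) : ℝ) : ℂ)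

lemma one_sub_mem_slitPlane {x : ℂ} (hx : ‖x‖ < 1) : 1 - x ∈ Complex.slitPlane := by
  left
  have := (Complex.re_le_norm x).trans_lt hx
  simpa using this

lemma sqrtOneSub_sq (x : ℂ) : sqrtOneSub x ^ 2 = 1 - x := by
  rw [sqrtOneSub, ← Complex.cpow_nat_mul]
  norm_num

lemma sqrtOneSub_zero : sqrtOneSub 0 = 1 := by simp [sqrtOneSub]

lemma sqrtOneSub_re_pos {x : ℂ} (hx : ‖x‖ < 1) : 0 < (sqrtOneSub x).re := by
  have h := one_sub_mem_slitPlane hx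
  have h0 : 0 < ‖1 - x‖ := norm_pos_iff.2 (Complex.slitPlane_ne_zero h)
  rw [sqrtOneSub, Complex.cpow_ofReal_re]
  refine mul_pos (Real.rpow_pos_of_pos h0 _) (Real.cos_pos_of_mem_Ioo ⟨?_, ?_⟩)
  · have := Complex.neg_pi_lt_arg (1 - x)
    linarith
  · have := lt_of_le_of_ne (Complex.arg_le_pi (1 - x)) (Complex.mem_slitPlane_iff_arg.1 h).1
    linarith

lemma sqrtOneSub_ne_zero {x : ℂ} (hx : ‖x‖ < 1) : sqrtOneSub x ≠ 0 := fun h => by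
  simpa [h] using sqrtOneSub_re_pos hx

lemma sqrtOneSub_norm_sq (x : ℂ) : ‖sqrtOneSub x‖ ^ 2 = ‖1 - x‖ := by
  rw [← norm_pow, sqrtOneSub_sq]

/-- Since `z² = 1 - x` has positive real part, `|arg z| < π/4`, so `2 Re z ≥ √2 ‖z‖`; `7/5` is a
rational lower bound for `√2`. -/
lemma norm_le_sqrtOneSub_re {x : ℂ} (hx : ‖x‖ < 1) :
    7 / 5 * ‖sqrtOneSub x‖ ≤ 2 * (sqrtOneSub x).re := by
  have h1 := sqrtOneSub_re_pos hx
  have h2 : 0 < (sqrtOneSub x ^ 2).re := by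
    rw [sqrtOneSub_sq]
    have := (Complex.re_le_norm x).trans_lt hx
    simpa using this
  have h3 := Complex.sq_norm (sqrtOneSub x)
  rw [Complex.normSq_apply] at h3
  rw [pow_two, Complex.mul_re] at h2
  refine abs_le_of_sq_le_sq' ?_ (by positivity) |>.2
  nlinarith

lemma differentiableAt_sqrtOneSub {x : ℂ} (hx : ‖x‖ < 1) :
    DifferentiableAt ℂ sqrtOneSub x :=
  (((differentiableAt_const _).sub differentiableAt_id).cpow (differentiableAt_const _)
    (one_sub_mem_slitPlane hx))

/-- Cauchy's estimate for the coefficients of the difference between a rational function and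
`1 / √(1 - x)`. -/
lemma abs_coeff_sub_le {F : ℝ⟦X⟧} (hF : F ^ 2 * (1 - PowerSeries.X) = 1)
    (hF0 : PowerSeries.coeff 0 F = 1) {P Q : ℝ[X]} {ρ M : ℝ} (hρ : 0 < ρ) (hρ1 : ρ < 1)
    (hQ : ∀ x : ℂ, ‖x‖ ≤ ρ → Polynomial.aeval x Q ≠ 0)
    (hM : ∀ x : ℂ, ‖x‖ ≤ ρ →
      ‖Polynomial.aeval x P / Polynomial.aeval x Q - 1 / sqrtOneSub x‖ ≤ M) (k : ℕ) :
    |PowerSeries.coeff k ((P : ℝ⟦X⟧) * (Q : ℝ⟦X⟧)⁻¹ - F)| ≤ M / ρ ^ k := by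
  have hPd : ∀ R : ℝ[X], Differentiable ℂ fun x : ℂ => Polynomial.aeval x R := fun R =>
    (Polynomial.contDiff_aeval R 1).differentiable one_ne_zero
  set r : ℂ → ℂ := fun x => Polynomial.aeval x P / Polynomial.aeval x Q with hr
  set g : ℂ → ℂ := fun x => 1 / sqrtOneSub x with hg
  have hrd : DifferentiableOn ℂ r (Metric.closedBall 0 ρ) := fun x hx =>
    ((hPd P x).div (hPd Q x) (hQ x (by simpa using hx))).differentiableWithinAt
  have hgd : DifferentiableOn ℂ g (Metric.closedBall 0 ρ) := fun x hx => by
    have hx1 : ‖x‖ < 1 := lt_of_le_of_lt (by simpa using hx) hρ1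
    exact ((differentiableAt_const _).div (differentiableAt_sqrtOneSub hx1)
      (sqrtOneSub_ne_zero hx1)).differentiableWithinAt
  have hnhds : Metric.closedBall (0 : ℂ) ρ ∈ nhds 0 := Metric.closedBall_mem_nhds 0 hρ
  have hrc := (hrd.analyticAt hnhds).contDiffAt (n := (⊤ : ℕ∞))
  have hgc := (hgd.analyticAt hnhds).contDiffAt (n := (⊤ : ℕ∞))
  have hQ0 : PowerSeries.constantCoeff (Q : ℝ⟦X⟧) ≠ 0 := by
    have := hQ 0 (by simpa using hρ.le)
    rw [← Polynomial.coeff_zero_eq_aeval_zero'] at this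
    simpa using this
  have hr1 : taylorPowerSeries r = PowerSeries.map (algebraMap ℝ ℂ) ((P : ℝ⟦X⟧) * (Q : ℝ⟦X⟧)⁻¹) := by
    have h1 : taylorPowerSeries r * PowerSeries.map (algebraMap ℝ ℂ) (Q : ℝ⟦X⟧) =
        PowerSeries.map (algebraMap ℝ ℂ) (P : ℝ⟦X⟧) := by
      rw [← taylorPowerSeries_aeval, ← taylorPowerSeries_aeval,
        ← taylorPowerSeries_mul hrc (Polynomial.contDiff_aeval Q _).contDiffAt]
      refine taylorPowerSeries_congr ?_
      filter_upwards [hnhds] with x hx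
      exact div_mul_cancel₀ _ (hQ x (by simpa using hx))
    have h2 : PowerSeries.map (algebraMap ℝ ℂ) (Q : ℝ⟦X⟧) *
        PowerSeries.map (algebraMap ℝ ℂ) (Q : ℝ⟦X⟧)⁻¹ = 1 := by
      rw [← map_mul, PowerSeries.mul_inv_cancel _ hQ0, map_one]
    rw [map_mul, ← h1, mul_assoc, h2, mul_one]
  have hg1 : taylorPowerSeries g = PowerSeries.map (algebraMap ℝ ℂ) F := by
    refine eq_of_sq_mul_one_sub_X (taylorPowerSeries_sq_mul hgc ?_) ?_ ?_ ?_
    · filter_upwards [hnhds] with x hx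
      have hx1 : ‖x‖ < 1 := lt_of_le_of_lt (by simpa using hx) hρ1
      rw [hg, ← sqrtOneSub_sq, ← mul_pow, one_div_mul_cancel (sqrtOneSub_ne_zero hx1), one_pow]
    · have := congrArg (PowerSeries.map (algebraMap ℝ ℂ)) hF
      simpa using this
    · rw [coeff_zero_taylorPowerSeries, hg]
      simp [sqrtOneSub_zero]
    · rw [PowerSeries.coeff_map, hF0, map_one]
  have hcoeff : (algebraMap ℝ ℂ) (PowerSeries.coeff k ((P : ℝ⟦X⟧) * (Q : ℝ⟦X⟧)⁻¹ - F)) =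
      iteratedDeriv k (r - g) 0 / (Nat.factorial k : ℂ) := by
    rw [← PowerSeries.coeff_map, map_sub, ← hr1, ← hg1, ← taylorPowerSeries_sub hrc hgc,
      taylorPowerSeries, PowerSeries.coeff_mk]
  have hd : DiffContOnCl ℂ (r - g) (Metric.ball 0 ρ) :=
    ((hrd.sub hgd).mono Metric.closure_ball_subset_closedBall).diffContOnCl
  have hbound := Complex.norm_iteratedDeriv_le_of_forall_mem_sphere_norm_le k hρ hd
    fun z hz => hM z (le_of_eq (by simpa using hz))
  have hfac : (0 : ℝ) < Nat.factorial k := Nat.cast_pos.2 (Nat.factorial_pos k)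
  calc _ = ‖(algebraMap ℝ ℂ) (PowerSeries.coeff k ((P : ℝ⟦X⟧) * (Q : ℝ⟦X⟧)⁻¹ - F))‖ := by
        rw [norm_algebraMap', Real.norm_eq_abs]
    _ = ‖iteratedDeriv k (r - g) 0‖ / Nat.factorial k := by
        rw [hcoeff, norm_div, Complex.norm_natCast]
    _ ≤ _ := by
        rw [div_le_iff₀ hfac]
        refine hbound.trans_eq ?_
        ring

/-! ### Newman's rational approximation of the square root -/

/-- A further factor `a + z` sends `(U, V)` to `(aU + XV, U + aV)`. The degree of `XV` is tracked
because `XV` enters the next `U` and later gives the numerator of `r`. -/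
lemma exists_even_odd_parts {ι : Type*} (s : Finset ι) (a : ι → ℝ) :
    ∃ U V : ℝ[X], 2 * U.natDegree ≤ s.card ∧ 2 * (Polynomial.X * V).natDegree ≤ s.card + 1 ∧
      ∀ z : ℂ, ∏ i ∈ s, ((a i : ℂ) + z) =
        Polynomial.aeval (z ^ 2) U + z * Polynomial.aeval (z ^ 2) V := by
  classical
  induction s using Finset.induction_on with
  | empty => exact ⟨1, 0, by simp, by simp, by simp⟩
  | insert i s hi ih =>
    obtain ⟨U, V, hU, hV, h⟩ := ih
    refine ⟨Polynomial.C (a i) * U + Polynomial.X * V, U + Polynomial.C (a i) * V, ?_, ?_,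
      fun z => ?_⟩
    · rw [Finset.card_insert_of_notMem hi]
      have h1 := Polynomial.natDegree_add_le (Polynomial.C (a i) * U) (Polynomial.X * V)
      have h2 := Polynomial.natDegree_C_mul_le (a i) U
      rcases le_max_iff.1 h1 with h1 | h1 <;> omega
    · rw [Finset.card_insert_of_notMem hi, mul_add, ← mul_assoc, mul_comm _ (Polynomial.C (a i)),
        mul_assoc]
      have h1 := Polynomial.natDegree_add_le (Polynomial.X * U)
        (Polynomial.C (a i) * (Polynomial.X * V))
      have h2 := Polynomial.natDegree_C_mul_le (a i) (Polynomial.X * V)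
      have h3 := Polynomial.natDegree_mul_le (p := Polynomial.X) (q := U)
      rw [Polynomial.natDegree_X] at h3
      rcases le_max_iff.1 h1 with h1 | h1 <;> omega
    · rw [Finset.prod_insert hi, h]
      simp only [map_add, map_mul, Polynomial.aeval_C, Polynomial.aeval_X, Complex.coe_algebraMap]
      ring

lemma norm_ofReal_sub_le {a : ℝ} (ha : 0 ≤ a) {z : ℂ} (hz : 0 ≤ z.re) :
    ‖(a : ℂ) - z‖ ≤ ‖(a : ℂ) + z‖ := by
  refine abs_le_of_sq_le_sq' ?_ (norm_nonneg _) |>.2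
  rw [Complex.sq_norm, Complex.sq_norm, Complex.normSq_apply, Complex.normSq_apply]
  simp only [Complex.sub_re, Complex.add_re, Complex.sub_im, Complex.add_im, Complex.ofReal_re,
    Complex.ofReal_im]
  nlinarith [mul_nonneg ha hz]

/-- With `s = a² + ‖z‖²`, the squared ratio is `(s - 2a Re z)/(s + 2a Re z) ≤ (3.2 - 1.4)/(3.2 +
1.4) < 2/5 ≤ e^(-4/5)`. -/
lemma norm_ofReal_sub_le_exp_mul {a : ℝ} {z : ℂ} (ha : 0 < a)
    (hz : 7 / 5 * ‖z‖ ≤ 2 * z.re) (haz : a ^ 2 + ‖z‖ ^ 2 ≤ 3.2 * (a * ‖z‖)) :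
    ‖(a : ℂ) - z‖ ≤ Real.exp (-(2 / 5)) * ‖(a : ℂ) + z‖ := by
  have hexp : (2 / 5 : ℝ) ≤ Real.exp (-(2 / 5)) ^ 2 := by
    rw [← Real.exp_nat_mul]
    have h1 : Real.exp (4 / 5) ≤ 5 / 2 := by
      have h2 : Real.exp (4 / 5) ^ 5 ≤ (5 / 2) ^ 5 := by
        rw [← Real.exp_nat_mul]
        have h3 : Real.exp (((5 : ℕ) : ℝ) * (4 / 5)) = Real.exp 1 ^ 4 := by
          rw [← Real.exp_nat_mul]
          norm_num
        rw [h3]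
        calc Real.exp 1 ^ 4 ≤ 2.7182818286 ^ 4 := by
              gcongr
              exact Real.exp_one_lt_d9.le
          _ ≤ _ := by norm_num
      exact le_of_pow_le_pow_left₀ (by norm_num) (by norm_num) h2
    rw [show ((2 : ℕ) : ℝ) * -(2 / 5) = -(4 / 5) by norm_num, Real.exp_neg,
      le_inv_comm₀ (by norm_num) (Real.exp_pos _)]
    linarith
  refine abs_le_of_sq_le_sq' ?_ (by positivity) |>.2
  have h1 : (2 / 5) * ‖(a : ℂ) + z‖ ^ 2 ≤ (Real.exp (-(2 / 5)) * ‖(a : ℂ) + z‖) ^ 2 := by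
    rw [mul_pow]
    gcongr
  refine le_trans ?_ h1
  have h2 := Complex.sq_norm z
  rw [Complex.normSq_apply] at h2
  rw [Complex.sq_norm, Complex.sq_norm, Complex.normSq_apply, Complex.normSq_apply]
  simp only [Complex.sub_re, Complex.add_re, Complex.sub_im, Complex.add_im, Complex.ofReal_re,
    Complex.ofReal_im]
  have h3 := mul_le_mul_of_nonneg_left hz ha.le
  nlinarith [mul_nonneg ha.le (norm_nonneg z)]

/-- For `a = e^(-2j)` one has `a² + r² = 2 cosh(log r + 2j) · a r`. Nodes spaced by 2 on the
logarithmic scale allow `|log r + 2j| ≤ 1`, and `2 cosh 1 ≤ 3.2`. -/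
lemma exists_exp_near {r : ℝ} {J : ℕ} (hr : 0 < r) (h1 : Real.log r ≤ 1)
    (hJ : 1 - Real.log r < 2 * J) :
    ∃ j < J, Real.exp (-2 * (j : ℝ)) ^ 2 + r ^ 2 ≤ 3.2 * (Real.exp (-2 * (j : ℝ)) * r) := by
  refine ⟨⌊(1 - Real.log r) / 2⌋₊, ?_, ?_⟩
  · rw [Nat.floor_lt (by linarith)]
    linarith
  set j := ⌊(1 - Real.log r) / 2⌋₊
  have hj1 : (j : ℝ) ≤ (1 - Real.log r) / 2 := Nat.floor_le (by linarith)
  have hj2 : (1 - Real.log r) / 2 < j + 1 := Nat.lt_floor_add_one _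
  have hcosh : Real.cosh (Real.log r + 2 * j) ≤ 1.6 := by
    calc _ ≤ Real.cosh 1 := by
          rw [Real.cosh_le_cosh, abs_one, abs_le]
          constructor <;> linarith
      _ ≤ 1.6 := by
          rw [Real.cosh_eq, Real.exp_neg]
          have h2 := Real.exp_one_lt_d9
          have h3 : (Real.exp 1)⁻¹ ≤ 1 / 2.7 := by
            rw [inv_eq_one_div]
            exact one_div_le_one_div_of_le (by norm_num) (by linarith [Real.exp_one_gt_d9])
          norm_num at h3 ⊢
          linarith
  have hid : Real.exp (-2 * (j : ℝ)) ^ 2 + r ^ 2 =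
      2 * Real.cosh (Real.log r + 2 * j) * (Real.exp (-2 * (j : ℝ)) * r) := by
    rw [Real.cosh_eq, neg_add, Real.exp_add, Real.exp_add, Real.exp_neg (Real.log r),
      Real.exp_log hr, neg_mul, Real.exp_neg]
    have := Real.exp_pos (2 * (j : ℝ))
    field_simp
    ring
  rw [hid]
  have : 0 ≤ Real.exp (-2 * (j : ℝ)) * r := by positivity
  nlinarith

/-- The nodes `exp (-2 j)`, `j < J`, each with multiplicity `μ`. -/
lemma norm_prod_sub_le {J μ : ℕ} {z : ℂ} (hz0 : z ≠ 0) (hz : 7 / 5 * ‖z‖ ≤ 2 * z.re)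
    (h1 : Real.log ‖z‖ ≤ 1) (hJ : 1 - Real.log ‖z‖ < 2 * J) :
    ‖∏ i ∈ Finset.range J ×ˢ Finset.range μ, ((Real.exp (-2 * (i.1 : ℝ)) : ℂ) - z)‖ ≤
      Real.exp (-(2 / 5) * μ) *
        ‖∏ i ∈ Finset.range J ×ˢ Finset.range μ, ((Real.exp (-2 * (i.1 : ℝ)) : ℂ) + z)‖ := by
  obtain ⟨j, hj, hjz⟩ := exists_exp_near (norm_pos_iff.2 hz0) h1 hJ
  have hre : 0 ≤ z.re := by linarith [norm_nonneg z]
  -- The node near `‖z‖` gains the factor `e^(-2/5)`; every other factor is at most 1 because `Re z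
  -- ≥ 0`.
  have key : ∏ i ∈ Finset.range J, ‖(Real.exp (-2 * (i : ℝ)) : ℂ) - z‖ ≤
      Real.exp (-(2 / 5)) * ∏ i ∈ Finset.range J, ‖(Real.exp (-2 * (i : ℝ)) : ℂ) + z‖ := by
    rw [← Finset.mul_prod_erase _ _ (Finset.mem_range.2 hj),
      ← Finset.mul_prod_erase _ (fun i : ℕ => ‖(Real.exp (-2 * (i : ℝ)) : ℂ) + z‖)
        (Finset.mem_range.2 hj), ← mul_assoc]
    refine mul_le_mul (norm_ofReal_sub_le_exp_mul (Real.exp_pos _) hz hjz) ?_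
      (Finset.prod_nonneg fun _ _ => norm_nonneg _) (by positivity)
    exact Finset.prod_le_prod (fun _ _ => norm_nonneg _)
      fun i _ => norm_ofReal_sub_le (Real.exp_pos _).le hre
  have e1 : ∀ g : ℕ → ℂ, ‖∏ i ∈ Finset.range J ×ˢ Finset.range μ, g i.1‖ =
      (∏ i ∈ Finset.range J, ‖g i‖) ^ μ := fun g => by
    rw [Finset.prod_product, ← Finset.prod_pow, norm_prod]
    refine Finset.prod_congr rfl fun i _ => ?_
    simp
  rw [e1 fun i => (Real.exp (-2 * (i : ℝ)) : ℂ) - z, e1 fun i => (Real.exp (-2 * (i : ℝ)) : ℂ) + z,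
    mul_comm _ (μ : ℝ), Real.exp_nat_mul, ← mul_pow]
  exact pow_le_pow_left₀ (Finset.prod_nonneg fun _ _ => norm_nonneg _) key μ

lemma prod_add_ne_zero {ι : Type*} {s : Finset ι} {a : ι → ℝ} (ha : ∀ i, 0 < a i) {z : ℂ}
    (hz : 0 ≤ z.re) : ∏ i ∈ s, ((a i : ℂ) + z) ≠ 0 := by
  refine Finset.prod_ne_zero_iff.2 fun i _ h => ?_
  have := congrArg Complex.re h
  simp at this
  linarith [ha i]

/-- If `u - z v` is small compared to `u + z v`, then `v / u` and `u / (z² v)` are close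
to `1 / z`. -/
lemma norm_ratio_sub_le {u v z : ℂ} {η : ℝ} (hη : η ≤ 1 / 2) (hz : z ≠ 0) (h0 : u + z * v ≠ 0)
    (h : ‖u - z * v‖ ≤ η * ‖u + z * v‖) :
    u ≠ 0 ∧ v ≠ 0 ∧ ‖v / u - 1 / z‖ ≤ 4 * η / ‖z‖ ∧
      ‖u / (z ^ 2 * v) - 1 / z‖ ≤ 4 * η / ‖z‖ := by
  have hP : 0 < ‖u + z * v‖ := norm_pos_iff.2 h0
  have hzn : 0 < ‖z‖ := norm_pos_iff.2 hz
  -- Write `2u` as the sum of `u + zv` and `u - zv`; since `η ≤ 1/2`, the second term cancels at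
  -- most half of the first.
  have hu : ‖u + z * v‖ ≤ 4 * ‖u‖ := by
    have h1 := norm_sub_le ((2 : ℂ) * u) (u - z * v)
    rw [show (2 : ℂ) * u - (u - z * v) = u + z * v by ring, norm_mul, Complex.norm_ofNat] at h1
    nlinarith
  have hv : ‖u + z * v‖ ≤ 4 * ‖z * v‖ := by
    have h1 := norm_add_le ((2 : ℂ) * (z * v)) (u - z * v)
    rw [show (2 : ℂ) * (z * v) + (u - z * v) = u + z * v by ring, norm_mul,
      Complex.norm_ofNat] at h1
    nlinarith
  have hu0 : u ≠ 0 := norm_pos_iff.1 (by linarith)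
  have hzv0 : z * v ≠ 0 := norm_pos_iff.1 (by linarith)
  have hv0 : v ≠ 0 := right_ne_zero_of_mul hzv0
  have hη0 : 0 ≤ η := nonneg_of_mul_nonneg_left ((norm_nonneg _).trans h) hP
  refine ⟨hu0, hv0, ?_, ?_⟩
  · rw [show v / u - 1 / z = -((u - z * v) / u) / z by field_simp; ring, norm_div, norm_neg,
      norm_div]
    gcongr
    rw [div_le_iff₀ (norm_pos_iff.2 hu0)]
    nlinarith
  · rw [show u / (z ^ 2 * v) - 1 / z = ((u - z * v) / (z * v)) / z by field_simp, norm_div,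
      norm_div]
    gcongr
    rw [div_le_iff₀ (norm_pos_iff.2 hzv0)]
    nlinarith

/-- The degree budget, with `L = log n` and `t² = d - 2`. The hypothesis on `d` gives `J ≤ πt/16 +
3/4`, so `Jμ` grows like `(5π/16) t²`, below `2t²`. -/
lemma nodes_count_le {L t : ℝ} {J μ : ℕ} (hL : 0 ≤ L) (ht : 12 + 4 * L ≤ Real.pi * t)
    (hJ : (J : ℝ) ≤ L / 4 + 3 / 2) (hμ : (μ : ℝ) ≤ 5 * t + 1) : (J : ℝ) * μ ≤ 2 * (t ^ 2 + 1) := by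
  have hpi := Real.pi_lt_d2
  have ht0 : 0 ≤ t := by
    by_contra h
    nlinarith [Real.pi_pos]
  have ht1 : 12 + 4 * L ≤ 3.15 * t := ht.trans (by gcongr)
  have ht2 : 3.8 ≤ t := by linarith
  calc (J : ℝ) * μ ≤ (3.15 * t / 16 + 3 / 4) * (5 * t + 1) := by
        gcongr
        linarith
    _ ≤ _ := by nlinarith

theorem exists_newman_approximation {n d : ℕ} (hn : 5 ≤ n)
    (hd : 2 + ((12 + 4 * Real.log n) / Real.pi) ^ 2 ≤ (d : ℝ)) :
    ∃ U V : ℝ[X], U.natDegree < d ∧ (Polynomial.X * V).natDegree < d ∧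
      ∀ x : ℂ, ‖x‖ ≤ 1 - 1 / n →
        Polynomial.aeval (1 - x) U ≠ 0 ∧ Polynomial.aeval (1 - x) V ≠ 0 ∧
        ‖Polynomial.aeval (1 - x) V / Polynomial.aeval (1 - x) U - 1 / sqrtOneSub x‖ ≤
          4 * Real.exp (-2 * √(d - 2)) * √n ∧
        ‖Polynomial.aeval (1 - x) U / ((1 - x) * Polynomial.aeval (1 - x) V) - 1 / sqrtOneSub x‖ ≤
          4 * Real.exp (-2 * √(d - 2)) * √n := by
  have hn0 : (0 : ℝ) < n := by positivity
  have hL : 0 ≤ Real.log n := Real.log_natCast_nonneg n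
  have hd2 : 0 ≤ (d : ℝ) - 2 := by
    have := sq_nonneg ((12 + 4 * Real.log n) / Real.pi)
    linarith
  set t := √((d : ℝ) - 2) with htdef
  have ht0 : 0 ≤ t := Real.sqrt_nonneg _
  have htsq : t ^ 2 = d - 2 := Real.sq_sqrt hd2
  have ht : 12 + 4 * Real.log n ≤ Real.pi * t := by
    rw [← div_le_iff₀' Real.pi_pos]
    exact Real.le_sqrt_of_sq_le (by linarith)
  -- Enough nodes to reach the smallest modulus `‖z‖ = n^(-1/2)`; the multiplicity `⌈5t⌉` then turns
  -- `e^(-2/5)` per repetition into `e^(-2t)`.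
  set J := ⌊(1 + Real.log n / 2) / 2⌋₊ + 1 with hJdef
  set μ := ⌈5 * t⌉₊ with hμdef
  have hJ1 : (J : ℝ) ≤ Real.log n / 4 + 3 / 2 := by
    have := Nat.floor_le (show 0 ≤ (1 + Real.log n / 2) / 2 by positivity)
    rw [hJdef]
    push_cast
    linarith
  have hJ2 : 1 + Real.log n / 2 < 2 * J := by
    have := Nat.lt_floor_add_one ((1 + Real.log n / 2) / 2)
    rw [hJdef]
    push_cast
    linarith
  have hμ1 : (μ : ℝ) ≤ 5 * t + 1 := (Nat.ceil_lt_add_one (by positivity)).le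
  have hμ2 : 5 * t ≤ μ := Nat.le_ceil _
  have hcard : J * μ + 2 ≤ 2 * d := by
    have h1 := nodes_count_le hL ht hJ1 hμ1
    rw [htsq] at h1
    have h2 : ((J * μ + 2 : ℕ) : ℝ) ≤ ((2 * d : ℕ) : ℝ) := by
      push_cast
      linarith
    exact_mod_cast h2
  obtain ⟨U, V, hU, hV, hUV⟩ := exists_even_odd_parts (Finset.range J ×ˢ Finset.range μ)
    fun i => Real.exp (-2 * (i.1 : ℝ))
  rw [Finset.card_product, Finset.card_range, Finset.card_range] at hU hV
  -- From `Jμ ≤ 2d - 2` both degrees are strictly below `d`, so `d` registers, counting register 0,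
  -- suffice.
  refine ⟨U, V, by omega, by omega, fun x hx => ?_⟩
  have hinv : 0 < 1 / (n : ℝ) := by positivity
  have hx1 : ‖x‖ < 1 := by linarith
  set z := sqrtOneSub x with hz
  have hz0 : z ≠ 0 := sqrtOneSub_ne_zero hx1
  have hzn : 0 < ‖z‖ := norm_pos_iff.2 hz0
  have hzsq : ‖z‖ ^ 2 = ‖1 - x‖ := sqrtOneSub_norm_sq x
  have hlow : 1 / (n : ℝ) ≤ ‖z‖ ^ 2 := by
    have := norm_sub_norm_le (1 : ℂ) x
    rw [norm_one] at this
    linarith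
  have hupp : ‖z‖ ^ 2 ≤ 2 := by
    have := norm_sub_le (1 : ℂ) x
    rw [norm_one] at this
    linarith
  have hlogsq : Real.log (‖z‖ ^ 2) = 2 * Real.log ‖z‖ := by rw [Real.log_pow]; norm_num
  have hlog1 : Real.log ‖z‖ ≤ 1 := by
    have := Real.log_le_sub_one_of_pos hzn
    nlinarith
  have hlog2 : -(Real.log n) ≤ 2 * Real.log ‖z‖ := by
    have := Real.log_le_log hinv hlow
    rwa [one_div, Real.log_inv, hlogsq] at this
  have hsmall := norm_prod_sub_le (μ := μ) hz0 (norm_le_sqrtOneSub_re hx1) hlog1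
    (show 1 - Real.log ‖z‖ < 2 * J by linarith)
  have hminus := hUV (-z)
  simp only [← sub_eq_add_neg, neg_sq] at hminus
  rw [hUV, hminus, sqrtOneSub_sq, neg_mul, ← sub_eq_add_neg] at hsmall
  have hne := prod_add_ne_zero (s := Finset.range J ×ˢ Finset.range μ)
    (a := fun i => Real.exp (-2 * (i.1 : ℝ))) (fun _ => Real.exp_pos _) (sqrtOneSub_re_pos hx1).le
  rw [hUV, sqrtOneSub_sq] at hne
  have ht1 : 1 ≤ t := by
    have := Real.pi_lt_d2
    nlinarith
  have hη : Real.exp (-2 * t) ≤ 1 / 2 := by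
    rw [neg_mul, Real.exp_neg, inv_eq_one_div]
    exact one_div_le_one_div_of_le (by norm_num) (by linarith [Real.add_one_le_exp (2 * t)])
  have hexp : Real.exp (-(2 / 5) * μ) ≤ Real.exp (-2 * t) := Real.exp_le_exp.2 (by linarith)
  obtain ⟨h1, h2, h3, h4⟩ := norm_ratio_sub_le hη hz0 hne
    (hsmall.trans (mul_le_mul_of_nonneg_right hexp (norm_nonneg _)))
  have hM : 4 * Real.exp (-2 * t) / ‖z‖ ≤ 4 * Real.exp (-2 * t) * √n := by
    rw [div_le_iff₀ hzn, mul_assoc]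
    refine le_mul_of_one_le_right (by positivity) ?_
    refine abs_le_of_sq_le_sq' ?_ (by positivity) |>.2
    rw [one_pow, mul_pow, Real.sq_sqrt hn0.le, mul_comm]
    rwa [div_le_iff₀ hn0] at hlow
  rw [sqrtOneSub_sq] at h4
  exact ⟨h1, h2, h3.trans hM, h4.trans hM⟩

/-- Cauchy's estimate costs `(1 - 1/n)^(-k) ≤ e ≤ 4` for `k < n`, hence `16 = 4 · 4`. The `√n` in
the disc bound is absorbed by weakening `e^(-2t)` to `e^(-πt/2)`; the remaining `√n` comes from
summing `n` squares. -/
lemma coeffNorm_sub_le_of_approx {n : ℕ} (hn : 5 ≤ n) {t : ℝ}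
    (ht : 12 + 4 * Real.log n ≤ Real.pi * t) {F : ℝ⟦X⟧}
    (hF : F ^ 2 * (1 - PowerSeries.X) = 1) (hF0 : PowerSeries.coeff 0 F = 1) {P Q : ℝ[X]}
    (hQ : ∀ x : ℂ, ‖x‖ ≤ 1 - 1 / n → Polynomial.aeval x Q ≠ 0)
    (hM : ∀ x : ℂ, ‖x‖ ≤ 1 - 1 / n →
      ‖Polynomial.aeval x P / Polynomial.aeval x Q - 1 / sqrtOneSub x‖ ≤
        4 * Real.exp (-2 * t) * √n) :
    coeffNorm ((P : ℝ⟦X⟧) * (Q : ℝ⟦X⟧)⁻¹) n ≤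
      coeffNorm F n + 16 * √n * Real.exp (-(Real.pi / 2) * t) := by
  have hn5 : (5 : ℝ) ≤ n := by exact_mod_cast hn
  have hn0 : (0 : ℝ) < n := by linarith
  have hn1 : (0 : ℝ) < n - 1 := by linarith
  have hρ : (0 : ℝ) < 1 - 1 / n := by
    rw [sub_pos, div_lt_one hn0]
    linarith
  have hρ1 : 1 - 1 / (n : ℝ) < 1 := by
    have : 0 < 1 / (n : ℝ) := by positivity
    linarith
  have hρinv : (1 - 1 / (n : ℝ))⁻¹ ≤ Real.exp (1 / (n - 1)) := by
    refine le_trans (le_of_eq ?_) (Real.add_one_le_exp _)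
    field_simp
    ring
  have hsqrt : √n * Real.exp (-2 * t) ≤ Real.exp (-(Real.pi / 2) * t) := by
    have h1 : √n = Real.exp (Real.log n / 2) := by
      rw [Real.sqrt_eq_rpow, Real.rpow_def_of_pos hn0]
      ring_nf
    rw [h1, ← Real.exp_add, Real.exp_le_exp]
    have h2 := Real.pi_lt_d2
    have h3 := Real.log_natCast_nonneg n
    have h4 : 0 ≤ t := by
      by_contra h
      nlinarith [Real.pi_pos]
    nlinarith
  have hbound : ∀ k < n, |PowerSeries.coeff k ((P : ℝ⟦X⟧) * (Q : ℝ⟦X⟧)⁻¹ - F)| ≤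
      16 * Real.exp (-(Real.pi / 2) * t) := fun k hk => by
    have hk1 : (k : ℝ) ≤ n - 1 := by
      have : ((k + 1 : ℕ) : ℝ) ≤ n := by exact_mod_cast hk
      push_cast at this
      linarith
    have hpow : ((1 - 1 / (n : ℝ)) ^ k)⁻¹ ≤ 4 := by
      calc ((1 - 1 / (n : ℝ)) ^ k)⁻¹ = ((1 - 1 / (n : ℝ))⁻¹) ^ k := (inv_pow _ _).symm
        _ ≤ Real.exp (1 / (n - 1)) ^ k := pow_le_pow_left₀ (inv_nonneg.2 hρ.le) hρinv k
        _ = Real.exp (k / (n - 1)) := by rw [← Real.exp_nat_mul]; ring_nf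
        _ ≤ Real.exp 1 := Real.exp_le_exp.2 ((div_le_one hn1).2 hk1)
        _ ≤ 4 := by linarith [Real.exp_one_lt_d9]
    refine (abs_coeff_sub_le hF hF0 hρ hρ1 hQ hM k).trans ?_
    rw [div_eq_mul_inv]
    calc _ ≤ 4 * Real.exp (-2 * t) * √n * 4 := by gcongr
      _ = 16 * (√n * Real.exp (-2 * t)) := by ring
      _ ≤ _ := by gcongr
  refine (coeffNorm_le_add _ F n).trans ?_
  have := coeffNorm_le_of_abs_le (by positivity) hbound
  linarith

/-! ### Substitution of `1 - x` and assembly of the factors -/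

lemma natDegree_C_mul_comp_one_sub_le (a : ℝ) (P : ℝ[X]) :
    (Polynomial.C a * P.comp (1 - Polynomial.X)).natDegree ≤ P.natDegree := by
  refine (Polynomial.natDegree_C_mul_le _ _).trans (Polynomial.natDegree_comp_le.trans ?_)
  have : (1 - Polynomial.X : ℝ[X]).natDegree ≤ 1 := by
    refine (Polynomial.natDegree_sub_le _ _).trans ?_
    simp
  nlinarith [P.natDegree.zero_le]

lemma aeval_C_mul_comp_one_sub (a : ℝ) (P : ℝ[X]) (x : ℂ) :
    Polynomial.aeval x (Polynomial.C a * P.comp (1 - Polynomial.X)) =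
      a * Polynomial.aeval (1 - x) P := by
  simp [Polynomial.aeval_comp]

lemma coeff_zero_C_mul_comp_one_sub (a : ℝ) (P : ℝ[X]) :
    (Polynomial.C a * P.comp (1 - Polynomial.X)).coeff 0 = a * P.eval 1 := by
  rw [Polynomial.coeff_zero_eq_eval_zero]
  simp [Polynomial.eval_comp]

lemma eval_one_ne_zero_of_aeval {P : ℝ[X]} (h : Polynomial.aeval (1 - 0 : ℂ) P ≠ 0) :
    P.eval 1 ≠ 0 := by
  intro h0
  have : Polynomial.aeval (1 - 0 : ℂ) P = ((P.eval 1 : ℝ) : ℂ) := by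
    have := Polynomial.aeval_algebraMap_apply_eq_algebraMap_eval (A := ℂ) (1 : ℝ) P
    simpa using this
  rw [this, h0] at h
  simp at h

theorem mainTheorem1 :
    -- two fixed programs and one absolute constant
    ∃ (r₁ r₂ : ℕ) (P₁ : Prog r₁) (P₂ : Prog r₂) (K : ℕ),
      ∀ n d : ℕ, 5 ≤ n → 2 + ((12 + 4 * Real.log n) / Real.pi) ^ 2 ≤ (d : ℝ) →
        -- `M(f, n)`, `f(x) = 1 / √(1 - x)`, is the optimal lower triangular Toeplitz factor
        (IsLTToeplitz (optFactor n) ∧ optFactor n * optFactor n = onesLT n ∧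
          ∀ B' C' : Matrix (Fin n) (Fin n) ℝ, IsLTToeplitz B' → IsLTToeplitz C' →
            B' * C' = onesLT n →
            rowNorm (optFactor n) * colNorm (optFactor n) ≤ rowNorm B' * colNorm C') ∧
        ∃ B C : Matrix (Fin n) (Fin n) ℝ,
          IsLTToeplitz B ∧ IsLTToeplitz C ∧ B * C = onesLT n ∧
          -- near-optimality
          rowNorm B ≤ rowNorm (optFactor n) +
            16 * Real.sqrt n * Real.exp (-(Real.pi / 2) * Real.sqrt ((d : ℝ) - 2)) ∧
          colNorm C ≤ colNorm (optFactor n) +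
            16 * Real.sqrt n * Real.exp (-(Real.pi / 2) * Real.sqrt ((d : ℝ) - 2)) ∧
          -- the factors come from a rational generating function `p / q` of degree at most `d`
          (∃ p q : ℝ[X], p.natDegree ≤ d ∧ q.natDegree ≤ d ∧ q.coeff 0 = 1 ∧ p.coeff 0 ≠ 0 ∧
            B = genMatrix ((p : ℝ⟦X⟧) * (q : ℝ⟦X⟧)⁻¹ * (1 - PowerSeries.X)⁻¹) n ∧
            C = genMatrix ((q : ℝ⟦X⟧) * (p : ℝ⟦X⟧)⁻¹) n ∧
            C⁻¹ = genMatrix ((p : ℝ⟦X⟧) * (q : ℝ⟦X⟧)⁻¹) n) ∧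
          HasBLTRecurrence d C⁻¹ ∧ HasBLTRecurrence (d + 1) B ∧
          -- efficiency
          ∀ m : ℕ, 1 ≤ m →
            P₁.StreamsWithin d m C⁻¹ (K * (d * m)) ∧ P₂.StreamsWithin d m B (K * (d * m)) := by
  refine ⟨10, 10, filterProg, filterProg, 27, fun n d hn hd => ?_⟩
  have hn0 : 0 < n := by omega
  obtain ⟨hF, hF0⟩ := taylorSeries_inv_sqrt
  refine ⟨genMatrix_optimal hF hF0 hn0, ?_⟩
  obtain ⟨U, V, hU, hV, hUV⟩ := exists_newman_approximation hn hd
  have ht : 12 + 4 * Real.log n ≤ Real.pi * √((d : ℝ) - 2) := by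
    rw [← div_le_iff₀' Real.pi_pos]
    exact Real.le_sqrt_of_sq_le (by linarith)
  have hρ : (0 : ℝ) ≤ 1 - 1 / n := by
    rw [sub_nonneg, div_le_one (by exact_mod_cast hn0)]
    exact_mod_cast hn0
  have hzero := hUV 0 (by simpa using hρ)
  have hU1 : U.eval 1 ≠ 0 := eval_one_ne_zero_of_aeval hzero.1
  have hV1 : V.eval 1 ≠ 0 := eval_one_ne_zero_of_aeval hzero.2.1
  have hα : (((U.eval 1)⁻¹ : ℝ) : ℂ) ≠ 0 := by simpa using hU1
  have hVd : V.natDegree < d := by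
    rcases eq_or_ne V 0 with rfl | hV0
    · simp at hV1
    · rw [Polynomial.natDegree_X_mul hV0] at hV
      omega
  -- Dividing by `U(1)` normalizes `q(0) = 1`. The factor `X` in `p` becomes `1 - x` and cancels
  -- against `1/(1 - x)`, so `B` is generated by `v/q`, again with degrees below `d`.
  set q := Polynomial.C (U.eval 1)⁻¹ * U.comp (1 - Polynomial.X) with hq
  set p := Polynomial.C (U.eval 1)⁻¹ * (Polynomial.X * V).comp (1 - Polynomial.X) with hp
  set v := Polynomial.C (U.eval 1)⁻¹ * V.comp (1 - Polynomial.X) with hv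
  have hqd : q.natDegree < d := (natDegree_C_mul_comp_one_sub_le _ _).trans_lt hU
  have hpd : p.natDegree < d := (natDegree_C_mul_comp_one_sub_le _ _).trans_lt hV
  have hvd : v.natDegree < d := (natDegree_C_mul_comp_one_sub_le _ _).trans_lt hVd
  have hq0 : q.coeff 0 = 1 := by
    rw [hq, coeff_zero_C_mul_comp_one_sub, inv_mul_cancel₀ hU1]
  have hp0 : p.coeff 0 ≠ 0 := by
    rw [hp, coeff_zero_C_mul_comp_one_sub]
    simp [hU1, hV1]
  have hqc : PowerSeries.constantCoeff (q : ℝ⟦X⟧) ≠ 0 := by simp [hq0]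
  have hpc : PowerSeries.constantCoeff (p : ℝ⟦X⟧) ≠ 0 := by simpa using hp0
  have hpv : (p : ℝ⟦X⟧) * (1 - PowerSeries.X)⁻¹ = v := by
    have h1 : p = v * (1 - Polynomial.X) := by
      rw [hp, hv, Polynomial.mul_comp, Polynomial.X_comp]
      ring
    have h2 : (p : ℝ⟦X⟧) = (v : ℝ⟦X⟧) * (1 - PowerSeries.X) := by
      rw [h1]
      simp
    rw [h2, mul_assoc, PowerSeries.mul_inv_cancel _ (by simp), mul_one]
  have hB : (p : ℝ⟦X⟧) * (q : ℝ⟦X⟧)⁻¹ * (1 - PowerSeries.X)⁻¹ = (v : ℝ⟦X⟧) * (q : ℝ⟦X⟧)⁻¹ := by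
    rw [← hpv]
    ring
  have hinv : (q : ℝ⟦X⟧) * (p : ℝ⟦X⟧)⁻¹ * ((p : ℝ⟦X⟧) * (q : ℝ⟦X⟧)⁻¹) = 1 := by
    linear_combination (p : ℝ⟦X⟧) * (p : ℝ⟦X⟧)⁻¹ * PowerSeries.mul_inv_cancel _ hqc +
      PowerSeries.mul_inv_cancel _ hpc
  have hCinv := genMatrix_inv hinv n
  have hqx : ∀ x : ℂ, ‖x‖ ≤ 1 - 1 / n → Polynomial.aeval x q ≠ 0 := fun x hx => by
    rw [hq, aeval_C_mul_comp_one_sub]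
    exact mul_ne_zero hα (hUV x hx).1
  have hpx : ∀ x : ℂ, Polynomial.aeval x p =
      (((U.eval 1)⁻¹ : ℝ) : ℂ) * ((1 - x) * Polynomial.aeval (1 - x) V) := fun x => by
    rw [hp, aeval_C_mul_comp_one_sub, map_mul, Polynomial.aeval_X]
  refine ⟨genMatrix ((v : ℝ⟦X⟧) * (q : ℝ⟦X⟧)⁻¹) n, genMatrix ((q : ℝ⟦X⟧) * (p : ℝ⟦X⟧)⁻¹) n,
    isLTToeplitz_genMatrix _ _, isLTToeplitz_genMatrix _ _, ?_, ?_, ?_,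
    ⟨p, q, hpd.le, hqd.le, hq0, hp0, by rw [hB], rfl, hCinv⟩, ?_,
    hasBLTRecurrence_genMatrix (by omega) (by omega) hq0 n, fun m hm => ⟨?_, ?_⟩⟩
  · rw [genMatrix_mul, ← hB, ← genMatrix_geometric]
    congr 1
    linear_combination (1 - PowerSeries.X)⁻¹ * hinv
  · rw [rowNorm_genMatrix _ hn0, optFactor, rowNorm_genMatrix _ hn0]
    refine coeffNorm_sub_le_of_approx hn ht hF hF0 hqx fun x hx => ?_
    rw [hv, hq, aeval_C_mul_comp_one_sub, aeval_C_mul_comp_one_sub, mul_div_mul_left _ _ hα]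
    exact (hUV x hx).2.2.1
  · rw [colNorm_genMatrix _ hn0, optFactor, colNorm_genMatrix _ hn0]
    refine coeffNorm_sub_le_of_approx hn ht hF hF0 (fun x hx => ?_) fun x hx => ?_
    · have hx1 : ‖x‖ < 1 := by
        have : 0 < 1 / (n : ℝ) := by positivity
        linarith
      rw [hpx]
      exact mul_ne_zero hα (mul_ne_zero (Complex.slitPlane_ne_zero (one_sub_mem_slitPlane hx1))
        (hUV x hx).2.1)
    · rw [hpx, hq, aeval_C_mul_comp_one_sub, mul_div_mul_left _ _ hα]
      exact (hUV x hx).2.2.2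
  · rw [hCinv]
    exact hasBLTRecurrence_genMatrix hpd hqd hq0 n
  · rw [hCinv]
    exact filterProg_streamsWithin hpd hqd hq0 n hm
  · exact filterProg_streamsWithin hvd hqd hq0 n hm
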